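/- Let $S_{2m}$ be the symmetric group on $2m$ letters. A pair $(h,v)\in S_{2m}\times S_{2m}$ defines a real origami of degree $2m$ if there is a fixed-point-free involution $\tau\in S_{2m}$ such that $\tau h\tau h^{-1}=\tau v\tau v=\mathrm{id}$, the cycles of $v$ (including those of length one) split into pairs $\gamma,\bar\gamma$ of distinct cycles with $\bar\gamma=\tau\gamma^{-1}\tau$, and the group generated by $h,v,\tau$ is transitive. The origami lies in the stratum $\mathcal H(1,1)$ (two simple zeros) if the commutator $hvh^{-1}v^{-1}$ is a product of two disjoint transpositions. Let $N_m^{\mathbb R}(1,1)$ be the number of isomorphism classes of real origami of degree $2m$ in $\mathcal H(1,1)$, each class (orbit of simultaneous conjugation) being counted with weight $1/|\mathrm{Aut}|$, where $\mathrm{Aut}$ is the stabilizer of $(h,v)$ in $S_{2m}$; equivalently, $N_m^{\mathbb R}(1,1)$ is the number of such pairs $(h,v)$ divided by $(2m)!$. Then the number of real origami in $\mathcal H(1,1)$ of degree at most $2n$ satisfies $$\sum_{m=1}^{n} N_m^{\mathbb R}(1,1)=\frac{\zeta(3)}{6}\,n^3+O(n^2)\qquad\text{as } n\to\infty .$$ 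-/

import Mathlib

open Equiv

/-- `τ` is a real structure for the pair of permutations `h, v` of the `2n` squares: `τ` is a
fixed-point-free involution with `τ h τ h⁻¹ = τ v τ v = 1`, the cycles of `v` split into pairs
`γ, γ̄` of distinct cycles with `γ̄ = τ γ⁻¹ τ`, and the group generated by `h`, `v`, `τ` is
transitive. -/
structure IsRealStructure {n : ℕ} (h v τ : Perm (Fin (2 * n))) : Prop where
  involutive : τ * τ = 1
  fixedPointFree : ∀ i, τ i ≠ i
  comm_h : τ * h * τ * h⁻¹ = 1
  inv_v : τ * v * τ * v = 1
  /-- Since `τ v⁻¹ τ = v`, the map `γ ↦ τ γ⁻¹ τ` is an involution of the set of cycles of `v`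
  (those of length one included), and it carries the cycle through `i` to the cycle through
  `τ i`. The cycles are therefore paired off exactly when no cycle is its own image, i.e. when
  `i` and `τ i` never lie on a common cycle. -/
  cycles_paired : ∀ i, ¬ v.SameCycle i (τ i)
  transitive : MulAction.IsPretransitive
    (Subgroup.closure ({h, v, τ} : Set (Perm (Fin (2 * n))))) (Fin (2 * n))

/-- The pair `(h, v)` of permutations of `2n` squares defines a real origami of degree `2n`. -/
def IsRealOrigami {n : ℕ} (h v : Perm (Fin (2 * n))) : Prop :=
  ∃ τ : Perm (Fin (2 * n)), IsRealStructure h v τ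

/-- The origami of `(h, v)` lies in the stratum whose differentials have zeros of the orders
listed in `orders` (positive integers). A cycle of length `k` of the commutator
`h v h⁻¹ v⁻¹` is a point of ramification index `k` over `0`, i.e. a zero of order `k - 1`;
`Equiv.Perm.cycleType` lists the lengths of the cycles of length at least two. -/
def InStratum {N : ℕ} (h v : Perm (Fin N)) (orders : Multiset ℕ) : Prop :=
  (h * v * h⁻¹ * v⁻¹).cycleType.map (fun k => k - 1) = orders

/-- The number of real origami of degree `2n` in the stratum with zero orders `orders`, each
isomorphism class (orbit of simultaneous conjugation by `S_{2n}`) being counted with weight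
`1 / |Aut|`, where `Aut` is the stabilizer of `(h, v)`. By the orbit-stabilizer theorem this is
the number of pairs `(h, v)` divided by `(2n)!`. -/
noncomputable def realOrigamiCount (n : ℕ) (orders : Multiset ℕ) : ℝ :=
  (Set.ncard {p : Perm (Fin (2 * n)) × Perm (Fin (2 * n)) |
    IsRealOrigami p.1 p.2 ∧ InStratum p.1 p.2 orders} : ℝ) / (Nat.factorial (2 * n) : ℝ)

/-! Write `c` for the commutator and `σ = v τ`, an involution that moves every point off its cycle
of `v`. Since `h` conjugates `σ` to `c σ`, the involution `c` commutes with `σ` and satisfies `c x ≠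
σ x`; so the four points moved by `c` are `a`, `c a`, `σ a`, `σ (c a)` for any one of them, `a`.
Also `h` conjugates `v` to `c v`. If `a` and `σ (c a)` lay on different cycles of `v`, then
multiplying by `c` would only split cycles or only merge them, which is impossible between conjugate
permutations. So `a` and `σ (c a)` share a cycle (`sameCycle_sigma_comm`).

Hence `c` preserves each pair of conjugate cycles and acts on one pair only. It follows that `h`
permutes the pairs (`circleRel_h_iff`), and by transitivity they form a single loop of `k` pairs of
circles of a common length `w`, with `m = w k`. The remaining data are the position `j ≠ 0` of `σ (c
a)` on the circle through `a` and the gluing `d` after one turn of the loop, one of the `2 w`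
automorphisms of a pair of circles (`exists_equiv_model`).

Marking the point `a` makes `j` and `d` unique and removes all automorphisms (`model_rigid`). There
are four choices of `a`, so the weighted count in degree `2 m` is the sum of `(w - 1) * 2 w / 4`
over the divisors `w` of `m`. Summing over `m ≤ n` and grouping by the codivisor `k` gives the sum
of `(M ^ 3 - M) / 6` with `M = ⌊n / k⌋`, whose main term is `n ^ 3 / 6` times a partial sum of
`ζ(3)`. -/

/-! ### A pair of oppositely oriented circles and its automorphisms -/

/-- The rotation of the pair of opposite circles `ZMod w × Bool`. -/
def circleRot (w : ℕ) : Perm (ZMod w × Bool) where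
  toFun y := (if y.2 then y.1 - 1 else y.1 + 1, y.2)
  invFun y := (if y.2 then y.1 + 1 else y.1 - 1, y.2)
  left_inv := by rintro ⟨x, _ | _⟩ <;> simp
  right_inv := by rintro ⟨x, _ | _⟩ <;> simp

/-- The exchange of the two circles of `ZMod w × Bool`. -/
def circleFlip (w : ℕ) : Perm (ZMod w × Bool) where
  toFun y := (y.1, !y.2)
  invFun y := (y.1, !y.2)
  left_inv := by rintro ⟨x, _ | _⟩ <;> simp
  right_inv := by rintro ⟨x, _ | _⟩ <;> simp

/-- The automorphism of the pair of circles carrying `(0, false)` to `d`. -/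
def circleAut {w : ℕ} (d : ZMod w × Bool) : Perm (ZMod w × Bool) where
  toFun y := (if d.2 then d.1 - y.1 else d.1 + y.1, xor y.2 d.2)
  invFun y := (if d.2 then d.1 - y.1 else y.1 - d.1, xor y.2 d.2)
  left_inv := by obtain ⟨s, _ | _⟩ := d <;> rintro ⟨x, _ | _⟩ <;> simp
  right_inv := by obtain ⟨s, _ | _⟩ := d <;> rintro ⟨x, _ | _⟩ <;> simp

@[simp] lemma circleRot_false {w : ℕ} (x : ZMod w) :
    circleRot w (x, false) = (x + 1, false) := rfl

@[simp] lemma circleRot_true {w : ℕ} (x : ZMod w) :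
    circleRot w (x, true) = (x - 1, true) := rfl

@[simp] lemma circleFlip_apply {w : ℕ} (y : ZMod w × Bool) :
    circleFlip w y = (y.1, !y.2) := rfl

lemma circleAut_zero {w : ℕ} (d : ZMod w × Bool) : circleAut d (0, false) = d := by
  obtain ⟨s, _ | _⟩ := d <;> simp [circleAut]

lemma circleAut_rot {w : ℕ} (d y : ZMod w × Bool) :
    circleAut d (circleRot w y) = circleRot w (circleAut d y) := by
  obtain ⟨s, _ | _⟩ := d <;> obtain ⟨x, _ | _⟩ := y <;> simp [circleAut] <;> ring

lemma circleAut_flip {w : ℕ} (d y : ZMod w × Bool) :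
    circleAut d (circleFlip w y) = circleFlip w (circleAut d y) := by
  obtain ⟨s, _ | _⟩ := d <;> obtain ⟨x, _ | _⟩ := y <;> simp [circleAut]

lemma circleRot_flip {w : ℕ} (y : ZMod w × Bool) :
    circleRot w (circleFlip w (circleRot w y)) = circleFlip w y := by
  obtain ⟨x, _ | _⟩ := y <;> simp

/-! ### Reversing an arc and the commutator it creates -/

section Arc

set_option linter.unusedSectionVars false

variable {w : ℕ} [NeZero w] {j : ZMod w}

lemma zmod_val_add_one {x : ZMod w} (h : x ≠ -1) : (x + 1).val = x.val + 1 := by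
  have hlt := ZMod.val_lt x
  have hx : ((x.val : ℕ) : ZMod w) = x := ZMod.natCast_zmod_val x
  rcases Nat.lt_or_ge (x.val + 1) w with h1 | h1
  · have : x + 1 = ((x.val + 1 : ℕ) : ZMod w) := by push_cast; rw [hx]
    rw [this, ZMod.val_natCast_of_lt h1]
  · exfalso
    apply h
    have h2 : x.val + 1 = w := by omega
    have : ((x.val + 1 : ℕ) : ZMod w) = 0 := by rw [h2]; simp
    push_cast at this
    rw [hx] at this
    exact eq_neg_of_add_eq_zero_left this

lemma zmod_val_reflect {x : ZMod w} (h : ¬ x.val < j.val) : ¬ (j - 1 - x).val < j.val := by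
  have hlt := ZMod.val_lt x
  have hj := ZMod.val_lt j
  have hx : ((x.val : ℕ) : ZMod w) = x := ZMod.natCast_zmod_val x
  have hj' : ((j.val : ℕ) : ZMod w) = j := ZMod.natCast_zmod_val j
  have : j - 1 - x = ((w + j.val - 1 - x.val : ℕ) : ZMod w) := by
    rw [Nat.cast_sub (by omega), Nat.cast_sub (by omega)]
    push_cast
    rw [hx, hj']; simp
  rw [this, ZMod.val_natCast_of_lt (by omega)]
  omega

lemma zmod_val_pred_lt (hj : j ≠ 0) : (j - 1).val < j.val := by
  have h : j - 1 ≠ -1 := fun h => hj (by simpa using h)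
  have := zmod_val_add_one h
  rw [sub_add_cancel] at this
  omega

lemma zmod_not_val_neg_one_lt : ¬ (-1 : ZMod w).val < j.val := by
  have hj := ZMod.val_lt j
  obtain ⟨n, rfl⟩ : ∃ n, w = n + 1 := ⟨w - 1, (Nat.succ_pred_eq_of_ne_zero (NeZero.ne w)).symm⟩
  rw [ZMod.val_neg_one]; omega

lemma zmod_zero_val_lt (hj : j ≠ 0) : (0 : ZMod w).val < j.val := by
  rw [ZMod.val_zero]
  exact Nat.pos_of_ne_zero (fun h => hj ((ZMod.val_eq_zero j).1 h))

lemma zmod_val_succ_lt {x : ZMod w} (h1 : x ≠ -1) (h2 : x ≠ j - 1) :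
    (x + 1).val < j.val ↔ x.val < j.val := by
  have h := zmod_val_add_one h1
  have h3 : (x + 1).val ≠ j.val := fun h => h2 (eq_sub_of_add_eq (ZMod.val_injective w h))
  omega

/-- The involution reversing the arc `[j, w)` and exchanging its two copies. -/
def arcFlip (j : ZMod w) : Perm (ZMod w × Bool) where
  toFun y := if y.1.val < j.val then y else (j - 1 - y.1, !y.2)
  invFun y := if y.1.val < j.val then y else (j - 1 - y.1, !y.2)
  left_inv := by
    rintro ⟨x, e⟩
    by_cases h : x.val < j.val
    · simp [h]
    · simp [h, zmod_val_reflect h]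
  right_inv := by
    rintro ⟨x, e⟩
    by_cases h : x.val < j.val
    · simp [h]
    · simp [h, zmod_val_reflect h]

lemma arcFlip_of_lt {y : ZMod w × Bool} (h : y.1.val < j.val) : arcFlip j y = y :=
  if_pos h

lemma arcFlip_of_not_lt {y : ZMod w × Bool} (h : ¬ y.1.val < j.val) :
    arcFlip j y = (j - 1 - y.1, !y.2) :=
  if_neg h

lemma arcFlip_arcFlip (y : ZMod w × Bool) : arcFlip j (arcFlip j y) = y :=
  (arcFlip j).left_inv y

lemma arcFlip_flip (y : ZMod w × Bool) :
    arcFlip j (circleFlip w y) = circleFlip w (arcFlip j y) := by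
  by_cases h : y.1.val < j.val
  · rw [arcFlip_of_lt h, arcFlip_of_lt]; exact h
  · rw [arcFlip_of_not_lt h, arcFlip_of_not_lt]; rfl; exact h

/-- The commutator created by `arcFlip`. -/
def arcComm (j : ZMod w) : Perm (ZMod w × Bool) :=
  swap (0, false) (j - 1, true) * swap (j, false) (-1, true)

lemma arcComm_apply (y : ZMod w × Bool) :
    arcComm j y = swap (0, false) (j - 1, true) (swap (j, false) (-1, true) y) := rfl

lemma arcComm_zero (hj : j ≠ 0) : arcComm j (0, false) = (j - 1, true) := by
  have h : swap (j, false) (-1, true) ((0 : ZMod w), false) = (0, false) :=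
    swap_apply_of_ne_of_ne (by simp [hj.symm]) (by simp)
  rw [arcComm_apply, h, swap_apply_left]

lemma arcComm_pred (hj : j ≠ 0) : arcComm j (j - 1, true) = (0, false) := by
  have h : swap (j, false) (-1, true) (j - 1, true) = (j - 1, true) :=
    swap_apply_of_ne_of_ne (by simp) (by simpa using hj)
  rw [arcComm_apply, h, swap_apply_right]

lemma arcComm_self (hj : j ≠ 0) : arcComm j (j, false) = (-1, true) := by
  rw [arcComm_apply, swap_apply_left, swap_apply_of_ne_of_ne (by simp)]
  simpa [eq_comm] using hj

lemma arcComm_neg_one (hj : j ≠ 0) : arcComm j (-1, true) = (j, false) := by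
  rw [arcComm_apply, swap_apply_right, swap_apply_of_ne_of_ne (by simpa using hj) (by simp)]

lemma arcComm_of_ne {y : ZMod w × Bool} (h1 : y ≠ (0, false)) (h2 : y ≠ (j - 1, true))
    (h3 : y ≠ (j, false)) (h4 : y ≠ (-1, true)) : arcComm j y = y := by
  rw [arcComm_apply, swap_apply_of_ne_of_ne h3 h4, swap_apply_of_ne_of_ne h1 h2]

/-- Reversing an arc while exchanging two oppositely oriented circles respects the rotation inside
the arc and inside its complement. The two differ only where the rotation crosses an end of the arc:
four places, accounting for the two transpositions. -/
lemma arcFlip_rot_arcFlip (hj : j ≠ 0) (y : ZMod w × Bool) :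
    arcFlip j (circleRot w (arcFlip j y)) = arcComm j (circleRot w y) := by
  obtain ⟨x, _ | _⟩ := y
  · by_cases h : x.val < j.val
    · rw [arcFlip_of_lt (y := (x, false)) h, circleRot_false]
      by_cases hx : x = j - 1
      · subst hx
        rw [sub_add_cancel, arcComm_self hj, arcFlip_of_not_lt (by simp)]
        simp
      have hx1 : x ≠ -1 := fun h1 => zmod_not_val_neg_one_lt (h1 ▸ h)
      rw [arcFlip_of_lt ((zmod_val_succ_lt hx1 hx).2 h), arcComm_of_ne] <;> simp
      · exact fun h => hx1 (eq_neg_of_add_eq_zero_left h)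
      · exact fun h => hx (eq_sub_of_add_eq h)
    · rw [arcFlip_of_not_lt (y := (x, false)) h]
      simp only [Bool.not_false, circleRot_true, circleRot_false]
      by_cases hx : x = -1
      · subst hx
        rw [neg_add_cancel, arcComm_zero hj]
        rw [show j - 1 - -1 - 1 = j - 1 by ring, arcFlip_of_lt (zmod_val_pred_lt hj)]
      have hx1 : x ≠ j - 1 := fun h1 => h (h1 ▸ zmod_val_pred_lt hj)
      have h2 := zmod_val_reflect ((zmod_val_succ_lt hx hx1).not.2 h)
      rw [show j - 1 - x - 1 = j - 1 - (x + 1) by ring, arcFlip_of_not_lt h2, arcComm_of_ne] <;> simp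
      · exact fun h => hx (eq_neg_of_add_eq_zero_left h)
      · exact fun h => hx1 (eq_sub_of_add_eq h)
  · by_cases h : x.val < j.val
    · rw [arcFlip_of_lt (y := (x, true)) h, circleRot_true]
      by_cases hx : x = 0
      · subst hx
        rw [zero_sub, arcComm_neg_one hj, arcFlip_of_not_lt zmod_not_val_neg_one_lt]
        simp
      have hx1 : x ≠ j := fun h1 => by subst h1; simp at h
      have h2 : (x - 1).val < j.val := by
        rwa [← zmod_val_succ_lt (by simpa using hx) (by simpa using hx1), sub_add_cancel]
      rw [arcFlip_of_lt h2, arcComm_of_ne] <;> simp [hx, hx1]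
    · rw [arcFlip_of_not_lt (y := (x, true)) h]
      simp only [Bool.not_true, circleRot_true, circleRot_false]
      by_cases hx : x = j
      · subst hx
        rw [arcComm_pred hj]
        rw [show x - 1 - x + 1 = 0 by ring, arcFlip_of_lt (zmod_zero_val_lt hj)]
      have hx1 : x ≠ 0 := fun h1 => h (h1 ▸ zmod_zero_val_lt hj)
      have h2 : ¬ (x - 1).val < j.val := by
        rwa [← zmod_val_succ_lt (by simpa using hx1) (by simpa using hx), sub_add_cancel]
      have h3 := zmod_val_reflect h2
      rw [show j - 1 - x + 1 = j - 1 - (x - 1) by ring, arcFlip_of_not_lt h3, arcComm_of_ne] <;>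
        simp [hx, hx1]

end Arc

/-! ### Real structures on an arbitrary set -/

/-- The conditions of `IsRealStructure`, stated pointwise and on an arbitrary set. -/
structure RealTriple {α : Type*} (h v τ : Perm α) : Prop where
  flip_flip : ∀ x, τ (τ x) = x
  flip_ne : ∀ x, τ x ≠ x
  flip_h : ∀ x, τ (h x) = h (τ x)
  v_flip_v : ∀ x, v (τ (v x)) = τ x
  not_sameCycle : ∀ x, ¬ v.SameCycle x (τ x)
  mem_of_invariant : ∀ S : Set α, S.Nonempty → (∀ x ∈ S, h x ∈ S) → (∀ x ∈ S, v x ∈ S) →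
    (∀ x ∈ S, τ x ∈ S) → ∀ x, x ∈ S

open scoped Pointwise in
lemma isRealStructure_iff {n : ℕ} {h v τ : Perm (Fin (2 * n))} :
    IsRealStructure h v τ ↔ RealTriple h v τ := by
  constructor
  · intro H
    have h1 : ∀ x, τ (τ x) = x := fun x => Perm.congr_fun H.involutive x
    refine ⟨h1, H.fixedPointFree, fun x => ?_, fun x => ?_, H.cycles_paired, ?_⟩
    · have := Perm.congr_fun H.comm_h (h x)
      simp only [Perm.mul_apply, Perm.one_apply, ← Perm.mul_apply h⁻¹ h, inv_mul_cancel] at this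
      rw [← this, h1]
    · have := Perm.congr_fun H.inv_v x
      simp only [Perm.mul_apply, Perm.one_apply] at this
      rw [← h1 (v (τ (v x))), this]
    · intro S hS hh hv hτ x
      obtain ⟨y, hy⟩ := hS
      have key : ∀ g : Perm (Fin (2 * n)), (∀ x ∈ S, g x ∈ S) → g ∈ MulAction.stabilizer
          (Perm (Fin (2 * n))) S := by
        intro g hg
        rw [MulAction.mem_stabilizer_iff]
        -- On a finite set forward invariance already gives `g • S = S`, so inverses need no
        -- separate hypothesis.
        refine Set.eq_of_subset_of_ncard_le ?_ ?_ (Set.toFinite _)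
        · rintro _ ⟨z, hz, rfl⟩
          exact hg z hz
        · exact (Set.ncard_smul_set g S).ge
      have hle : Subgroup.closure ({h, v, τ} : Set (Perm (Fin (2 * n)))) ≤
          MulAction.stabilizer (Perm (Fin (2 * n))) S := by
        rw [Subgroup.closure_le]
        rintro g (rfl | rfl | rfl)
        exacts [key _ hh, key _ hv, key _ hτ]
      obtain ⟨⟨g, hg⟩, hgx⟩ := H.transitive.exists_smul_eq y x
      have := hle hg
      rw [MulAction.mem_stabilizer_iff] at this
      rw [← this, ← hgx]
      exact Set.smul_mem_smul_set hy
  · intro H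
    refine ⟨?_, H.flip_ne, ?_, ?_, H.not_sameCycle, ⟨fun x y => ?_⟩⟩
    · ext1 x; exact H.flip_flip x
    · ext1 x
      simp only [Perm.mul_apply, Perm.one_apply]
      rw [H.flip_h, H.flip_flip, ← Perm.mul_apply, mul_inv_cancel, Perm.one_apply]
    · ext1 x
      simp only [Perm.mul_apply, Perm.one_apply]
      rw [H.v_flip_v, H.flip_flip]
    · have key : ∀ g ∈ ({h, v, τ} : Set (Perm (Fin (2 * n)))),
          ∀ z ∈ MulAction.orbit (Subgroup.closure ({h, v, τ} : Set (Perm (Fin (2 * n))))) x,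
          g z ∈ MulAction.orbit
            (Subgroup.closure ({h, v, τ} : Set (Perm (Fin (2 * n))))) x := by
        rintro g hg _ ⟨u, rfl⟩
        exact ⟨⟨g, Subgroup.subset_closure hg⟩ * u, mul_smul _ _ _⟩
      exact H.mem_of_invariant _ ⟨x, MulAction.mem_orbit_self x⟩ (key h (by simp))
        (key v (by simp)) (key τ (by simp)) y

lemma RealTriple.permCongr {α β : Type*} {h v τ : Perm α} (H : RealTriple h v τ) (e : α ≃ β) :
    RealTriple (e.permCongr h) (e.permCongr v) (e.permCongr τ) := by
  refine ⟨?_, ?_, ?_, ?_, ?_, ?_⟩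
  · intro x; simp [permCongr_apply, H.flip_flip]
  · intro x hx
    apply H.flip_ne (e.symm x)
    rw [permCongr_apply] at hx
    rw [← e.apply_eq_iff_eq, hx, e.apply_symm_apply]
  · intro x; simp [permCongr_apply, H.flip_h]
  · intro x; simp [permCongr_apply, H.v_flip_v]
  · rintro x ⟨n, hn⟩
    apply H.not_sameCycle (e.symm x)
    refine ⟨n, ?_⟩
    have : e.permCongr v ^ n = e.permCongr (v ^ n) := (map_zpow e.permCongrHom v n).symm
    rw [this, permCongr_apply, permCongr_apply] at hn
    exact e.injective hn
  · intro S ⟨y, hy⟩ hh hv hτ x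
    have := H.mem_of_invariant (e ⁻¹' S) ⟨e.symm y, by simpa using hy⟩
      (fun z hz => by simpa [permCongr_apply] using hh _ hz)
      (fun z hz => by simpa [permCongr_apply] using hv _ hz)
      (fun z hz => by simpa [permCongr_apply] using hτ _ hz) (e.symm x)
    simpa using this

/-! ### The model surface with `k` levels of width `w` -/

section Model

set_option linter.unusedSectionVars false

variable {w k : ℕ}

/-- The vertical permutation of the model: `k` pairs of circles of length `w`. -/
def modelV (w k : ℕ) : Perm (ZMod k × (ZMod w × Bool)) := prodCongrRight fun _ => circleRot w

/-- The real structure of the model. -/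
def modelFlip (w k : ℕ) : Perm (ZMod k × (ZMod w × Bool)) := prodCongrRight fun _ => circleFlip w

/-- The horizontal permutation of the model: a shift of the levels, followed by a regluing
of the level `0`. -/
def modelH (k : ℕ) [NeZero w] (j : ZMod w) (d : ZMod w × Bool) :
    Perm (ZMod k × (ZMod w × Bool)) :=
  (Equiv.addRight (1 : ZMod k)).prodCongr (Equiv.refl _) |>.trans
    (Perm.prodExtendRight 0 (arcFlip j * circleAut d))

lemma modelV_apply (i : ZMod k) (y : ZMod w × Bool) : modelV w k (i, y) = (i, circleRot w y) := rfl

lemma modelFlip_apply (i : ZMod k) (y : ZMod w × Bool) :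
    modelFlip w k (i, y) = (i, circleFlip w y) := rfl

variable [NeZero w]

lemma modelH_of_eq (j : ZMod w) (d : ZMod w × Bool) {i : ZMod k} (hi : i + 1 = 0)
    (y : ZMod w × Bool) : modelH k j d (i, y) = (0, arcFlip j (circleAut d y)) := by
  have : modelH k j d (i, y) = Perm.prodExtendRight 0 (arcFlip j * circleAut d) (i + 1, y) := rfl
  rw [this, hi, Perm.prodExtendRight_apply_eq]; rfl

lemma modelH_of_ne (j : ZMod w) (d : ZMod w × Bool) {i : ZMod k} (hi : i + 1 ≠ 0)
    (y : ZMod w × Bool) : modelH k j d (i, y) = (i + 1, y) := by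
  have : modelH k j d (i, y) = Perm.prodExtendRight 0 (arcFlip j * circleAut d) (i + 1, y) := rfl
  rw [this, Perm.prodExtendRight_apply_ne _ hi]

/-- The shift of levels and `circleAut d` commute with the rotation, so the whole defect comes from
`arcFlip` at level `0`. -/
lemma modelH_modelV {j : ZMod w} (hj : j ≠ 0) (d : ZMod w × Bool) (y : ZMod k × (ZMod w × Bool)) :
    modelH k j d (modelV w k y) =
      Perm.prodExtendRight 0 (arcComm j) (modelV w k (modelH k j d y)) := by
  obtain ⟨i, y⟩ := y
  by_cases hi : i + 1 = 0
  · rw [modelV_apply, modelH_of_eq _ _ hi, modelH_of_eq _ _ hi, modelV_apply,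
      Perm.prodExtendRight_apply_eq, ← arcFlip_rot_arcFlip hj, arcFlip_arcFlip, circleAut_rot]
  · rw [modelV_apply, modelH_of_ne _ _ hi, modelH_of_ne _ _ hi, modelV_apply,
      Perm.prodExtendRight_apply_ne _ hi]

lemma modelH_comm {j : ZMod w} (hj : j ≠ 0) (d : ZMod w × Bool) :
    modelH k j d * modelV w k * (modelH k j d)⁻¹ * (modelV w k)⁻¹ =
      Perm.prodExtendRight 0 (arcComm j) := by
  rw [mul_inv_eq_iff_eq_mul, mul_inv_eq_iff_eq_mul]
  ext1 y
  exact modelH_modelV hj d y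

lemma prodExtendRight_arcComm (j : ZMod w) :
    Perm.prodExtendRight (0 : ZMod k) (arcComm j) =
      swap (0, (0, false)) (0, (j - 1, true)) * swap (0, (j, false)) (0, (-1, true)) := by
  have key : ∀ a b : ZMod w × Bool, Perm.prodExtendRight (0 : ZMod k) (swap a b) =
      swap (0, a) (0, b) := by
    intro a b
    ext1 ⟨i, y⟩
    by_cases hi : i = 0
    · subst hi
      rw [Perm.prodExtendRight_apply_eq]
      simp only [swap_apply_def, Prod.mk.injEq, true_and]
      split_ifs <;> rfl
    · rw [Perm.prodExtendRight_apply_ne _ hi, swap_apply_of_ne_of_ne] <;> simp [hi]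
  rw [← key, ← key]
  ext1 ⟨i, y⟩
  by_cases hi : i = 0
  · subst hi
    simp only [Perm.mul_apply, Perm.prodExtendRight_apply_eq]; rfl
  · simp only [Perm.mul_apply, Perm.prodExtendRight_apply_ne _ hi]

lemma modelV_pow (n : ℕ) (i : ZMod k) (y : ZMod w × Bool) :
    (modelV w k ^ n) (i, y) = (i, ((circleRot w) ^ n) y) := by
  induction n with
  | zero => rfl
  | succ n ih => rw [pow_succ', pow_succ', Perm.mul_apply, ih]; rfl

lemma circleRot_pow_false (n : ℕ) (x : ZMod w) :
    ((circleRot w) ^ n) (x, false) = (x + n, false) := by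
  induction n with
  | zero => simp
  | succ n ih => rw [pow_succ', Perm.mul_apply, ih]; simp; ring

lemma circleRot_pow_snd (n : ℕ) (y : ZMod w × Bool) : (((circleRot w) ^ n) y).2 = y.2 := by
  induction n with
  | zero => rfl
  | succ n ih => rw [pow_succ', Perm.mul_apply, ← ih]; rfl

lemma model_realTriple [NeZero k] {j : ZMod w} (d : ZMod w × Bool) :
    RealTriple (modelH k j d) (modelV w k) (modelFlip w k) := by
  refine ⟨?_, ?_, ?_, ?_, ?_, ?_⟩
  · rintro ⟨i, x, e⟩; simp [modelFlip_apply]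
  · rintro ⟨i, x, e⟩; simp [modelFlip_apply]
  · rintro ⟨i, y⟩
    by_cases hi : i + 1 = 0
    · rw [modelFlip_apply i y, modelH_of_eq _ _ hi, modelH_of_eq _ _ hi, modelFlip_apply,
        circleAut_flip, arcFlip_flip]
    · rw [modelFlip_apply i y, modelH_of_ne _ _ hi, modelH_of_ne _ _ hi, modelFlip_apply]
  · rintro ⟨i, y⟩
    rw [modelV_apply, modelFlip_apply, modelV_apply, circleRot_flip, modelFlip_apply]
  · rintro ⟨i, y⟩ hy
    obtain ⟨n, hn⟩ := hy.exists_nat_pow_eq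
    rw [modelV_pow, modelFlip_apply] at hn
    have := circleRot_pow_snd n y
    rw [(Prod.mk.inj hn).2] at this
    simp at this
  · intro S ⟨⟨i, z⟩, hy⟩ hh hv hτ
    have rot : ∀ i : ZMod k, ∀ x : ZMod w, (i, (x, false)) ∈ S → ∀ t : ZMod w × Bool,
        (i, t) ∈ S := by
      intro i x hx
      have h1 : ∀ n : ℕ, (i, (x + n, false)) ∈ S := by
        intro n
        induction n with
        | zero => simpa using hx
        | succ n ih =>
          have := hv _ ih
          rw [modelV_apply, circleRot_false, add_assoc] at this
          simpa using this
      have h2 : ∀ t : ZMod w, (i, (t, false)) ∈ S := by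
        intro t
        have := h1 (t - x).val
        rwa [ZMod.natCast_zmod_val, add_sub_cancel] at this
      rintro ⟨t, _ | _⟩
      · exact h2 t
      · exact hτ _ (h2 t)
    have lev : ∀ i : ZMod k, ∀ y, (i, y) ∈ S → ∀ t : ZMod w × Bool, (i, t) ∈ S := by
      rintro i ⟨x, _ | _⟩ hx
      · exact rot i x hx
      · exact rot i x (hτ _ hx)
    have h3 : ∀ n : ℕ, ∀ t, (i + n, t) ∈ S := by
      intro n
      induction n with
      | zero => simpa using lev i z hy
      | succ n ih =>
        have := hh _ (ih z)
        have h4 : ∃ y, modelH k j d (i + n, z) = (i + n + 1, y) := by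
          by_cases hi : i + n + 1 = 0
          · rw [modelH_of_eq _ _ hi, hi]; exact ⟨_, rfl⟩
          · rw [modelH_of_ne _ _ hi]; exact ⟨_, rfl⟩
        obtain ⟨y, h4⟩ := h4
        rw [h4] at this
        have := lev _ _ this
        simpa [add_assoc] using this
    rintro ⟨i', t⟩
    have := h3 (i' - i).val t
    rwa [ZMod.natCast_zmod_val, add_sub_cancel] at this

end Model

/-! ### The stratum condition as a cycle type -/

lemma cycleType_swap_mul_swap {α : Type*} [Fintype α] [DecidableEq α] {a b c d : α}
    (hab : a ≠ b) (hcd : c ≠ d) (hac : a ≠ c) (had : a ≠ d) (hbc : b ≠ c) (hbd : b ≠ d) :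
    (swap a b * swap c d).cycleType = {2, 2} := by
  have hd : Perm.Disjoint (swap a b) (swap c d) := by
    rw [Perm.disjoint_iff_disjoint_support, Perm.support_swap hab, Perm.support_swap hcd]
    simp [hac.symm, had.symm, hbc.symm, hbd.symm]
  rw [hd.cycleType_mul, (Perm.swap_isSwap_iff.2 hab).isCycle.cycleType,
    (Perm.swap_isSwap_iff.2 hcd).isCycle.cycleType, Perm.card_support_swap hab,
    Perm.card_support_swap hcd]
  rfl

lemma inStratum_one_one_iff {N : ℕ} {h v : Perm (Fin N)} :
    InStratum h v {1, 1} ↔ (h * v * h⁻¹ * v⁻¹).cycleType = {2, 2} := by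
  unfold InStratum
  constructor
  · intro H
    -- The truncated subtraction can be undone because the lengths in `cycleType` are at least two.
    have h2 : ∀ k ∈ (h * v * h⁻¹ * v⁻¹).cycleType, ((fun k => k + 1) ∘ fun k => k - 1) k = id k :=
        fun k hk => by
      simp only [Function.comp_apply, id]
      have := Perm.two_le_of_mem_cycleType hk; omega
    have := congrArg (Multiset.map (fun k => k + 1)) H
    rw [Multiset.map_map, Multiset.map_congr (g := id) rfl h2, Multiset.map_id] at this
    rw [this]; rfl
  · intro H
    rw [H]; rfl

/-! ### Comparing the cycles of `v` and `c * v` -/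

section Perm

variable {α : Type*}

lemma perm_pow_mod_apply {v : Perm α} {a : α} {t : ℕ} (h : (v ^ t) a = a) (n : ℕ) :
    (v ^ (n % t)) a = (v ^ n) a := by
  have h1 : ∀ m : ℕ, ((v ^ t) ^ m) a = a := by
    intro m
    induction m with
    | zero => rfl
    | succ m ih => rw [pow_succ, Perm.mul_apply, h, ih]
  conv_rhs => rw [← Nat.mod_add_div n t, pow_add, pow_mul, Perm.mul_apply, h1]

/-- The orbits of `a` under `c * v` and `v` agree until the latter meets the support of `c`; this is
how merging and splitting of cycles are detected. -/
lemma mul_pow_apply_of_fixed {c v : Perm α} {a : α} {t : ℕ}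
    (h : ∀ s, 0 < s → s < t → c ((v ^ s) a) = (v ^ s) a) :
    ∀ s < t, ((c * v) ^ s) a = (v ^ s) a := by
  intro s
  induction s with
  | zero => intro _; rfl
  | succ s ih =>
    intro hs
    rw [pow_succ', Perm.mul_apply, ih (by omega), Perm.mul_apply, ← Perm.mul_apply v, ← pow_succ',
      h _ (by omega) hs]

lemma mul_pow_apply_first_return {c v : Perm α} {a : α} {t : ℕ} (ht : 0 < t)
    (h : ∀ s, 0 < s → s < t → c ((v ^ s) a) = (v ^ s) a) :
    ((c * v) ^ t) a = c ((v ^ t) a) := by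
  obtain ⟨t, rfl⟩ : ∃ s, t = s + 1 := ⟨t - 1, by omega⟩
  rw [pow_succ', Perm.mul_apply, mul_pow_apply_of_fixed h t (by omega), Perm.mul_apply,
    ← Perm.mul_apply v, ← pow_succ']

/-- A bijection preserves the number of related pairs, so on a finite set an inclusion between
conjugate relations is an equality. This replaces counting cycles. -/
lemma rel_of_rel_of_le [Finite α] {r r' : α → α → Prop} (h : Perm α)
    (hr : ∀ x y, r x y ↔ r' (h x) (h y)) (hle : ∀ x y, r' x y → r x y) (x y : α) (hxy : r x y) :
    r' x y := by
  have h1 : {p : α × α | r' p.1 p.2}.ncard = {p : α × α | r p.1 p.2}.ncard := by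
    have : {p : α × α | r' p.1 p.2} = (h.prodCongr h) '' {p : α × α | r p.1 p.2} := by
      ext ⟨x, y⟩
      simp only [Set.mem_ofPred_eq, Set.mem_image, Prod.exists, prodCongr_apply, Prod.map_apply,
        Prod.mk.injEq]
      constructor
      · intro hxy
        exact ⟨h.symm x, h.symm y, (hr _ _).2 (by simpa using hxy), by simp, by simp⟩
      · rintro ⟨x, y, hxy, rfl, rfl⟩
        exact (hr _ _).1 hxy
    rw [this, Set.ncard_image_of_injective _ (h.prodCongr h).injective]
  have h2 : {p : α × α | r' p.1 p.2} = {p : α × α | r p.1 p.2} :=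
    Set.eq_of_subset_of_ncard_le (fun p hp => hle _ _ hp) h1.ge (Set.toFinite _)
  have : (x, y) ∈ {p : α × α | r' p.1 p.2} := by rw [h2]; exact hxy
  exact this

lemma sameCycle_le_of_apply [Finite α] {v : Perm α} {r : α → α → Prop} (hr : Equivalence r)
    (h : ∀ x, r (v x) x) {x y : α} (hxy : v.SameCycle x y) : r x y := by
  obtain ⟨n, rfl⟩ := hxy.exists_nat_pow_eq
  clear hxy
  induction n with
  | zero => exact hr.refl x
  | succ n ih =>
    rw [pow_succ', Perm.mul_apply]
    exact hr.trans ih (hr.symm (h _))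

end Perm

/-! ### The commutator acts inside one pair of conjugate cycles -/

/-- `x` and `y` lie on the same pair of conjugate cycles of `v`. -/
def CircleRel {α : Type*} (v τ : Perm α) (x y : α) : Prop :=
  v.SameCycle x y ∨ v.SameCycle x (τ y)

namespace RealTriple

variable {α : Type*} {h v τ c : Perm α} (H : RealTriple h v τ)
include H

lemma v_pow_flip_v_pow (n : ℕ) (x : α) : (v ^ n) (τ ((v ^ n) x)) = τ x := by
  induction n generalizing x with
  | zero => rfl
  | succ n ih =>
    rw [pow_succ, Perm.mul_apply, Perm.mul_apply, ← Perm.mul_apply (v ^ n) v x, ← pow_succ, pow_succ',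
      Perm.mul_apply v, H.v_flip_v, ih]

lemma sameCycle_flip [Finite α] {x y : α} (hxy : v.SameCycle x y) :
    v.SameCycle (τ x) (τ y) := by
  obtain ⟨n, rfl⟩ := hxy.exists_nat_pow_eq
  refine Perm.SameCycle.symm ⟨n, ?_⟩
  rw [zpow_natCast, H.v_pow_flip_v_pow]

lemma circleRel_equivalence [Finite α] : Equivalence (CircleRel v τ) := by
  refine ⟨fun x => Or.inl (Perm.SameCycle.refl _ _), ?_, ?_⟩
  · rintro x y (hxy | hxy)
    · exact Or.inl hxy.symm
    · refine Or.inr ?_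
      have := H.sameCycle_flip hxy
      rw [H.flip_flip] at this
      exact this.symm
  · rintro x y z (hxy | hxy) (hyz | hyz)
    · exact Or.inl (hxy.trans hyz)
    · exact Or.inr (hxy.trans hyz)
    · exact Or.inr (hxy.trans (H.sameCycle_flip hyz))
    · have := H.sameCycle_flip hyz
      rw [H.flip_flip] at this
      exact Or.inl (hxy.trans this)

lemma sigma_sigma (x : α) : v (τ (v (τ x))) = x := by
  rw [H.v_flip_v, H.flip_flip]

lemma sigma_sameCycle [Finite α] {x y : α} (hxy : v.SameCycle x y) :
    v.SameCycle (v (τ x)) (v (τ y)) := by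
  rw [Perm.sameCycle_apply_left, Perm.sameCycle_apply_right]
  exact H.sameCycle_flip hxy

lemma not_sameCycle_sigma (x : α) : ¬ v.SameCycle x (v (τ x)) := by
  rw [Perm.sameCycle_apply_right]
  exact H.not_sameCycle x

/-- With `σ = v τ`, this says that `h` conjugates `σ` to `c σ`, so `c σ` inherits every property of
`σ` that is invariant under conjugation. -/
lemma comm_sigma_h (hc : ∀ x, h (v x) = c (v (h x))) (y : α) :
    c (v (τ (h y))) = h (v (τ y)) := by
  rw [H.flip_h, hc]

/-- As a conjugate of `σ`, `c σ` is an involution; since `c` and `σ` are involutions too, they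
commute. -/
lemma comm_sigma (hc : ∀ x, h (v x) = c (v (h x))) (hcc : ∀ x, c (c x) = x) (x : α) :
    c (v (τ x)) = v (τ (c x)) := by
  have h1 : ∀ x, c (v (τ (c (v (τ x))))) = x := by
    intro x
    obtain ⟨y, rfl⟩ := h.surjective x
    rw [H.comm_sigma_h hc, H.comm_sigma_h hc, H.sigma_sigma]
  have h3 : v (τ (c (v (τ x)))) = c x := by rw [← hcc (v (τ (c (v (τ x))))), h1]
  rw [← h3, H.sigma_sigma]

/-- As a conjugate of `σ`, `c σ` has no fixed point. -/
lemma comm_ne_sigma (hc : ∀ x, h (v x) = c (v (h x))) (x : α) : c x ≠ v (τ x) := by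
  have h1 : ∀ x, c (v (τ x)) ≠ x := by
    intro x
    obtain ⟨y, rfl⟩ := h.surjective x
    rw [H.comm_sigma_h hc]
    intro hy
    apply H.not_sameCycle_sigma y
    rw [h.injective hy]
  intro hx
  apply h1 (v (τ x))
  rw [H.sigma_sigma, hx]

lemma mem_support_comm [Fintype α] [DecidableEq α] (hc : ∀ x, h (v x) = c (v (h x)))
    (hcc : ∀ x, c (c x) = x) (hcard : c.support.card = 4) {a : α} (ha : c a ≠ a) {x : α}
    (hx : c x ≠ x) : x = a ∨ x = c a ∨ x = v (τ a) ∨ x = v (τ (c a)) := by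
  have hσ : ∀ x, v (τ x) ≠ x := fun x hx => H.not_sameCycle_sigma x (by rw [hx])
  have hσi : ∀ x y, v (τ x) = v (τ y) → x = y := fun x y hxy => τ.injective (v.injective hxy)
  have h1 := H.comm_ne_sigma hc a
  have h2 : v (τ (c a)) ≠ a := fun h => h1 (by rw [← h, H.sigma_sigma, h])
  have hs : ({a, c a, v (τ a), v (τ (c a))} : Finset α) = c.support := by
    apply Finset.eq_of_subset_of_card_le
    · intro y hy
      rw [Perm.mem_support]
      simp only [Finset.mem_insert, Finset.mem_singleton] at hy
      rcases hy with rfl | rfl | rfl | rfl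
      · exact ha
      · exact fun h => ha (c.injective h)
      · rw [H.comm_sigma hc hcc]; exact fun h => ha (hσi _ _ h)
      · rw [H.comm_sigma hc hcc]; exact fun h => ha (c.injective (hσi _ _ h))
    · rw [hcard, Finset.card_insert_of_notMem, Finset.card_insert_of_notMem,
        Finset.card_insert_of_notMem, Finset.card_singleton]
      · simp only [Finset.mem_singleton]; exact fun h => ha (hσi _ _ h).symm
      · simp only [Finset.mem_insert, Finset.mem_singleton, not_or]
        exact ⟨h1, (hσ _).symm⟩
      · simp only [Finset.mem_insert, Finset.mem_singleton, not_or]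
        exact ⟨ha.symm, (hσ _).symm, h2.symm⟩
  have := hs.symm ▸ Perm.mem_support.2 hx
  simpa using this

omit H in
lemma sameCycle_iff_mul (hc : ∀ x, h (v x) = c (v (h x))) (x y : α) :
    v.SameCycle x y ↔ (c * v).SameCycle (h x) (h y) := by
  have : c * v = h * v * h⁻¹ := by
    rw [eq_mul_inv_iff_mul_eq]
    ext1 x
    exact (hc x).symm
  rw [this, Perm.sameCycle_conj]
  simp

omit H in
lemma exists_first_return [Fintype α] (a : α) :
    ∃ t, 0 < t ∧ (v ^ t) a = a ∧ ∀ s, 0 < s → s < t → (v ^ s) a ≠ a := by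
  classical
  have hex : ∃ t, 0 < t ∧ (v ^ t) a = a := ⟨orderOf v, orderOf_pos v, by rw [pow_orderOf_eq_one]; rfl⟩
  obtain ⟨h1, h2⟩ := Nat.find_spec hex
  exact ⟨Nat.find hex, h1, h2, fun s hs hst hsa => Nat.find_min hex hst ⟨hs, hsa⟩⟩

/-- Merging: `a` is the only point of its `v`-cycle moved by `c`, so `c * v` follows the whole cycle
and then jumps to `c a`. -/
lemma sameCycle_mul_of_not_sameCycle [Fintype α] [DecidableEq α]
    (hc : ∀ x, h (v x) = c (v (h x)))
    (hcc : ∀ x, c (c x) = x) (hcard : c.support.card = 4) {a : α} (ha : c a ≠ a)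
    (h1 : ¬ v.SameCycle a (c a)) (h2 : ¬ v.SameCycle a (v (τ (c a)))) :
    (c * v).SameCycle a (c a) := by
  obtain ⟨t, ht, hta, hmin⟩ := exists_first_return (v := v) a
  refine ⟨t, ?_⟩
  rw [zpow_natCast, mul_pow_apply_first_return ht, hta]
  intro s hs hst
  by_contra hne
  have hsame : v.SameCycle a ((v ^ s) a) := ⟨s, by rw [zpow_natCast]⟩
  rcases H.mem_support_comm hc hcc hcard ha hne with h | h | h | h
  · exact hmin s hs hst h
  · exact h1 (h ▸ hsame)
  · exact H.not_sameCycle_sigma a (h ▸ hsame)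
  · exact h2 (h ▸ hsame)

/-- Splitting: the first moved point that the `v`-orbit of `a` meets is `c a`, and there `c` sends
the path back to `a`. The loop closes before visiting `c a`. -/
lemma not_sameCycle_mul_of_sameCycle [Fintype α] [DecidableEq α]
    (hc : ∀ x, h (v x) = c (v (h x)))
    (hcc : ∀ x, c (c x) = x) (hcard : c.support.card = 4) {a : α} (ha : c a ≠ a)
    (h1 : v.SameCycle a (c a)) (h2 : ¬ v.SameCycle a (v (τ (c a)))) :
    ¬ (c * v).SameCycle a (c a) := by
  obtain ⟨t, ht, hta, hmin⟩ : ∃ t, 0 < t ∧ ((v ^ t) a = a ∨ (v ^ t) a = c a) ∧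
      ∀ s, 0 < s → s < t → ¬ ((v ^ s) a = a ∨ (v ^ s) a = c a) := by
    have hex : ∃ t, 0 < t ∧ ((v ^ t) a = a ∨ (v ^ t) a = c a) :=
      ⟨orderOf v, orderOf_pos v, Or.inl (by rw [pow_orderOf_eq_one]; rfl)⟩
    obtain ⟨h1, h2⟩ := Nat.find_spec hex
    exact ⟨Nat.find hex, h1, h2, fun s hs hst hsa => Nat.find_min hex hst ⟨hs, hsa⟩⟩
  have hta' : (v ^ t) a = c a := by
    rcases hta with hta | hta
    · exfalso
      obtain ⟨n, hn⟩ := h1.exists_nat_pow_eq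
      rw [← perm_pow_mod_apply hta] at hn
      rcases Nat.eq_zero_or_pos (n % t) with h0 | h0
      · rw [h0] at hn; exact ha hn.symm
      · exact hmin _ h0 (Nat.mod_lt _ ht) (Or.inr hn)
    · exact hta
  have hfix : ∀ s, 0 < s → s < t → c ((v ^ s) a) = (v ^ s) a := by
    intro s hs hst
    by_contra hne
    have hsame : v.SameCycle a ((v ^ s) a) := ⟨s, by rw [zpow_natCast]⟩
    rcases H.mem_support_comm hc hcc hcard ha hne with h | h | h | h
    · exact hmin s hs hst (Or.inl h)
    · exact hmin s hs hst (Or.inr h)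
    · exact H.not_sameCycle_sigma a (h ▸ hsame)
    · exact h2 (h ▸ hsame)
  have hret : ((c * v) ^ t) a = a := by rw [mul_pow_apply_first_return ht hfix, hta', hcc]
  intro hsame
  obtain ⟨n, hn⟩ := hsame.exists_nat_pow_eq
  have hlt := Nat.mod_lt n ht
  rw [← perm_pow_mod_apply hret, mul_pow_apply_of_fixed hfix _ hlt] at hn
  rcases Nat.eq_zero_or_pos (n % t) with h0 | h0
  · rw [h0] at hn; exact ha hn.symm
  · exact hmin _ h0 hlt (Or.inr hn)

lemma sameCycle_sigma_comm [Fintype α] [DecidableEq α] (hc : ∀ x, h (v x) = c (v (h x)))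
    (hcc : ∀ x, c (c x) = x) (hcard : c.support.card = 4) {a : α} (ha : c a ≠ a) :
    v.SameCycle a (v (τ (c a))) := by
  by_contra h2
  by_cases h1 : v.SameCycle a (c a)
  · apply H.not_sameCycle_mul_of_sameCycle hc hcc hcard ha h1 h2
    -- Now `c` preserves every cycle of `v`, so the cycles of `c * v` refine those of `v`; being
    -- conjugate they coincide, against the splitting at `a`.
    have h3 : ∀ x, v.SameCycle x (c x) := by
      intro x
      by_cases hx : c x = x
      · rw [hx]
      rcases H.mem_support_comm hc hcc hcard ha hx with rfl | rfl | rfl | rfl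
      · exact h1
      · rw [hcc]; exact h1.symm
      · rw [H.comm_sigma hc hcc]; exact H.sigma_sameCycle h1
      · rw [H.comm_sigma hc hcc, hcc]; exact H.sigma_sameCycle h1.symm
    refine rel_of_rel_of_le h (sameCycle_iff_mul hc) (fun x y hxy => ?_) _ _ h1
    refine sameCycle_le_of_apply (Perm.SameCycle.equivalence v) (fun x => ?_) hxy
    exact (Perm.sameCycle_apply_left.1 (h3 (v x))).symm
  · have h3 : (c * v).SameCycle a (c a) :=
      H.sameCycle_mul_of_not_sameCycle hc hcc hcard ha h1 h2
    have h4 : (c * v).SameCycle (v (τ a)) (c (v (τ a))) := by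
      have key : ∀ x y, v.SameCycle (v (τ x)) (v (τ y)) → v.SameCycle x y := fun x y hxy => by
        have := H.sigma_sameCycle hxy
        rwa [H.sigma_sigma, H.sigma_sigma] at this
      apply H.sameCycle_mul_of_not_sameCycle hc hcc hcard
      · rw [H.comm_sigma hc hcc]
        exact fun h => ha (τ.injective (v.injective h))
      · rw [H.comm_sigma hc hcc]
        exact fun h => h1 (key _ _ h)
      · rw [H.comm_sigma hc hcc]
        exact fun h => h2 (key _ _ h)
    -- The mirror case: `c` preserves every cycle of `c * v`, so the cycles of `v` refine those of
    -- `c * v`, and equality contradicts the merging.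
    have h5 : ∀ x, (c * v).SameCycle x (c x) := by
      intro x
      by_cases hx : c x = x
      · rw [hx]
      rcases H.mem_support_comm hc hcc hcard ha hx with rfl | rfl | rfl | rfl
      · exact h3
      · rw [hcc]; exact h3.symm
      · exact h4
      · rw [← H.comm_sigma hc hcc, hcc]; exact h4.symm
    apply h1
    refine rel_of_rel_of_le h⁻¹ (fun x y => ?_) (fun x y hxy => ?_) _ _ h3
    · rw [sameCycle_iff_mul hc]; simp
    · refine sameCycle_le_of_apply (Perm.SameCycle.equivalence (c * v)) (fun x => ?_) hxy
      have h6 := h5 (c (v x))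
      rw [hcc] at h6
      exact (h6.symm.trans (Perm.sameCycle_apply_left.2 (Perm.SameCycle.refl (c * v) x)))

lemma circleRel_of_comm_ne [Fintype α] [DecidableEq α] (hc : ∀ x, h (v x) = c (v (h x)))
    (hcc : ∀ x, c (c x) = x) (hcard : c.support.card = 4) {a : α} (ha : c a ≠ a) {x : α}
    (hx : c x ≠ x) : CircleRel v τ a x := by
  have hb := H.sameCycle_sigma_comm hc hcc hcard ha
  rcases H.mem_support_comm hc hcc hcard ha hx with rfl | rfl | rfl | rfl
  · exact Or.inl (Perm.SameCycle.refl _ _)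
  · exact Or.inr (Perm.sameCycle_apply_right.1 hb)
  · exact H.circleRel_equivalence.symm (Or.inr (Perm.sameCycle_apply_left.2 (Perm.SameCycle.refl _ _)))
  · exact Or.inl hb

/-- `h` carries the pairs of cycles of `v` to those of `c * v`. As `c` preserves each pair for `v`,
the latter refine the former, and finiteness makes them equal. -/
lemma circleRel_h_iff [Fintype α] [DecidableEq α] (hc : ∀ x, h (v x) = c (v (h x)))
    (hcc : ∀ x, c (c x) = x) (hcard : c.support.card = 4) {a : α} (ha : c a ≠ a) (x y : α) :
    CircleRel v τ (h x) (h y) ↔ CircleRel v τ x y := by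
  have hR := H.circleRel_equivalence
  have key : ∀ x y, CircleRel v τ x y ↔ CircleRel (c * v) τ (h x) (h y) := by
    intro x y
    unfold CircleRel
    rw [H.flip_h, ← sameCycle_iff_mul hc, ← sameCycle_iff_mul hc]
  have hcR : ∀ z, CircleRel v τ (c z) z := by
    intro z
    by_cases hz : c z = z
    · rw [hz]; exact hR.refl z
    · exact hR.trans
        (hR.symm (H.circleRel_of_comm_ne hc hcc hcard ha (fun h => hz (c.injective h))))
        (H.circleRel_of_comm_ne hc hcc hcard ha hz)
  have hle1 : ∀ x y, (c * v).SameCycle x y → CircleRel v τ x y := fun x y hxy =>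
    sameCycle_le_of_apply hR
      (fun x => hR.trans (hcR (v x)) (Or.inl (Perm.sameCycle_apply_left.2 (Perm.SameCycle.refl _ _))))
      hxy
  have hle : ∀ x y, CircleRel (c * v) τ x y → CircleRel v τ x y := by
    rintro x y (hxy | hxy)
    · exact hle1 _ _ hxy
    · exact hR.trans (hle1 _ _ hxy) (Or.inr (Perm.SameCycle.refl _ _))
  rw [key x y]
  exact ⟨rel_of_rel_of_le h key hle _ _, hle _ _⟩

end RealTriple

/-! ### Coordinates on a pair of conjugate cycles -/

/-- The parametrization of the pair of cycles of `v` through `a` and `τ a`. -/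
def circleParam {α : Type*} (v τ : Perm α) (a : α) (w : ℕ) (y : ZMod w × Bool) : α :=
  if y.2 then τ ((v ^ y.1.val) a) else (v ^ y.1.val) a

section

variable {α : Type*} {v τ : Perm α} {a : α} {w : ℕ}

lemma circleParam_false (x : ZMod w) : circleParam v τ a w (x, false) = (v ^ x.val) a := rfl

lemma circleParam_true (x : ZMod w) : circleParam v τ a w (x, true) = τ ((v ^ x.val) a) := rfl

lemma circleParam_zero : circleParam v τ a w (0, false) = a := by
  rw [circleParam_false, ZMod.val_zero]; rfl

lemma circleParam_natCast (hw : (v ^ w) a = a) (n : ℕ) :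
    circleParam v τ a w (n, false) = (v ^ n) a := by
  rw [circleParam_false, ZMod.val_natCast, perm_pow_mod_apply hw]

lemma pow_val_add_one [NeZero w] (hw : (v ^ w) a = a) (x : ZMod w) :
    (v ^ (x + 1).val) a = v ((v ^ x.val) a) := by
  have : x + 1 = ((x.val + 1 : ℕ) : ZMod w) := by push_cast; rw [ZMod.natCast_zmod_val]
  rw [this, ZMod.val_natCast, perm_pow_mod_apply hw, pow_succ', Perm.mul_apply]

lemma RealTriple.circleParam_rot {h : Perm α} (H : RealTriple h v τ) [NeZero w]
    (hw : (v ^ w) a = a) (y : ZMod w × Bool) :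
    circleParam v τ a w (circleRot w y) = v (circleParam v τ a w y) := by
  obtain ⟨x, _ | _⟩ := y
  · rw [circleRot_false, circleParam_false, circleParam_false, pow_val_add_one hw]
  · obtain ⟨x, rfl⟩ : ∃ z, x = z + 1 := ⟨x - 1, by ring⟩
    rw [circleRot_true, circleParam_true, circleParam_true, add_sub_cancel_right,
      pow_val_add_one hw, H.v_flip_v]

lemma RealTriple.circleParam_flip {h : Perm α} (H : RealTriple h v τ)
    (y : ZMod w × Bool) :
    circleParam v τ a w (circleFlip w y) = τ (circleParam v τ a w y) := by
  obtain ⟨x, _ | _⟩ := y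
  · rfl
  · exact (H.flip_flip _).symm

lemma RealTriple.circleRel_circleParam {h : Perm α} (H : RealTriple h v τ) (y : ZMod w × Bool) :
    CircleRel v τ a (circleParam v τ a w y) := by
  obtain ⟨x, _ | _⟩ := y
  · exact Or.inl ⟨x.val, by rw [zpow_natCast]; rfl⟩
  · refine Or.inr ⟨x.val, ?_⟩
    rw [zpow_natCast, circleParam_true, H.flip_flip]

lemma RealTriple.exists_circleParam [Finite α] {h : Perm α} (H : RealTriple h v τ) [NeZero w]
    (hw : (v ^ w) a = a) {z : α} (hz : CircleRel v τ a z) :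
    ∃ y, circleParam v τ a w y = z := by
  rcases hz with hz | hz
  · obtain ⟨n, rfl⟩ := hz.exists_nat_pow_eq
    exact ⟨_, circleParam_natCast hw n⟩
  · obtain ⟨n, hn⟩ := hz.exists_nat_pow_eq
    refine ⟨circleFlip w (n, false), ?_⟩
    rw [H.circleParam_flip, circleParam_natCast hw, hn, H.flip_flip]

/-- Minimality of `w` separates points of one circle; `not_sameCycle` separates the two circles. -/
lemma RealTriple.circleParam_injective {h : Perm α} (H : RealTriple h v τ) [NeZero w]
    (hmin : ∀ s, 0 < s → s < w → (v ^ s) a ≠ a) :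
    Function.Injective (circleParam v τ a w) := by
  have h0 : ∀ m n : ℕ, m < w → n < w → m ≤ n → (v ^ m) a = (v ^ n) a → m = n := by
    intro m n hm hn hle hmn
    by_contra hne
    apply hmin (n - m) (by omega) (by omega)
    apply (v ^ m).injective
    rw [← Perm.mul_apply, ← pow_add, hmn]
    congr 2; omega
  have h1 : ∀ x y : ZMod w, (v ^ x.val) a = (v ^ y.val) a → x = y := by
    intro x y hxy
    apply ZMod.val_injective
    rcases Nat.le_total x.val y.val with hle | hle
    · exact h0 _ _ (ZMod.val_lt x) (ZMod.val_lt y) hle hxy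
    · exact (h0 _ _ (ZMod.val_lt y) (ZMod.val_lt x) hle hxy.symm).symm
  have h2 : ∀ x y : ZMod w, (v ^ x.val) a ≠ τ ((v ^ y.val) a) := by
    intro x y hxy
    apply H.not_sameCycle ((v ^ y.val) a)
    rw [← hxy]
    exact Perm.sameCycle_pow_left.2 (Perm.sameCycle_pow_right.2 (Perm.SameCycle.refl _ _))
  rintro ⟨x, _ | _⟩ ⟨y, _ | _⟩ hxy
  · rw [h1 x y hxy]
  · exact absurd hxy (h2 x y)
  · exact absurd hxy.symm (h2 y x)
  · rw [h1 x y (τ.injective hxy)]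

/-- Two maps on a pair of circles with the same equivariance and the same base value agree. -/
lemma circle_map_ext [NeZero w] {f g : ZMod w × Bool → α} {u t : α → α}
    (hf : ∀ y, f (circleRot w y) = u (f y)) (hg : ∀ y, g (circleRot w y) = u (g y))
    (hf' : ∀ y, f (circleFlip w y) = t (f y)) (hg' : ∀ y, g (circleFlip w y) = t (g y))
    (h0 : f (0, false) = g (0, false)) (y : ZMod w × Bool) : f y = g y := by
  have h1 : ∀ n : ℕ, f (n, false) = g (n, false) := by
    intro n
    induction n with
    | zero => simpa using h0
    | succ n ih =>
      have h2 : (((n + 1 : ℕ) : ZMod w), false) = circleRot w (n, false) := by simp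
      rw [h2, hf, hg, ih]
  have h2 : ∀ x : ZMod w, f (x, false) = g (x, false) := by
    intro x
    have := h1 x.val
    rwa [ZMod.natCast_zmod_val] at this
  obtain ⟨x, _ | _⟩ := y
  · exact h2 x
  · have h3 : (x, true) = circleFlip w (x, false) := rfl
    rw [h3, hf', hg', h2]

end

/-! ### Every marked real origami is a model -/

namespace RealTriple

variable {α : Type*} [Fintype α] [DecidableEq α] {h v τ c : Perm α} (H : RealTriple h v τ)
include H

/-- The parameter `j` is the position of `σ (c a)` on the circle through `a`. Applying `σ` locates
`c a` and `σ a` on the other circle, which places all four moved points. -/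
lemma exists_circleParam_arcComm (hc : ∀ x, h (v x) = c (v (h x)))
    (hcc : ∀ x, c (c x) = x) (hcard : c.support.card = 4) {a : α} (ha : c a ≠ a)
    {w : ℕ} [NeZero w] (hw : (v ^ w) a = a) (hmin : ∀ s, 0 < s → s < w → (v ^ s) a ≠ a) :
    ∃ j : ZMod w, j ≠ 0 ∧ ∀ y, circleParam v τ a w (arcComm j y) = c (circleParam v τ a w y) := by
  have hinj := H.circleParam_injective hmin
  obtain ⟨n, hn⟩ := (H.sameCycle_sigma_comm hc hcc hcard ha).exists_nat_pow_eq
  obtain ⟨j, hj⟩ : ∃ j : ZMod w, circleParam v τ a w (j, false) = v (τ (c a)) :=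
    ⟨n, by rw [circleParam_natCast hw, hn]⟩
  have hj0 : j ≠ 0 := by
    rintro rfl
    rw [circleParam_zero] at hj
    exact H.comm_ne_sigma hc a (by conv_rhs => rw [hj, H.sigma_sigma])
  have hca : circleParam v τ a w (j - 1, true) = c a := by
    have : (j - 1, true) = circleRot w (circleFlip w (j, false)) := rfl
    rw [this, H.circleParam_rot hw, H.circleParam_flip, hj, H.sigma_sigma]
  have hsa : circleParam v τ a w (-1, true) = v (τ a) := by
    have : ((-1 : ZMod w), true) = circleRot w (circleFlip w (0, false)) := by simp
    rw [this, H.circleParam_rot hw, H.circleParam_flip, circleParam_zero]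
  refine ⟨j, hj0, fun y => ?_⟩
  by_cases h1 : y = (0, false)
  · rw [h1, arcComm_zero hj0, hca, circleParam_zero]
  by_cases h2 : y = (j - 1, true)
  · rw [h2, arcComm_pred hj0, hca, circleParam_zero, hcc]
  by_cases h3 : y = (j, false)
  · rw [h3, arcComm_self hj0, hj, hsa, H.comm_sigma hc hcc, hcc]
  by_cases h4 : y = (-1, true)
  · rw [h4, arcComm_neg_one hj0, hj, hsa, H.comm_sigma hc hcc]
  rw [arcComm_of_ne h1 h2 h3 h4]
  by_contra hne
  rcases H.mem_support_comm hc hcc hcard ha (Ne.symm hne) with h | h | h | h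
  · exact h1 (hinj (h.trans circleParam_zero.symm))
  · exact h2 (hinj (h.trans hca.symm))
  · exact h4 (hinj (h.trans hsa.symm))
  · exact h3 (hinj (h.trans hj.symm))

lemma circleRel_h_pow_iff (hc : ∀ x, h (v x) = c (v (h x)))
    (hcc : ∀ x, c (c x) = x) (hcard : c.support.card = 4) {a : α} (ha : c a ≠ a) (n : ℕ) (x y : α) :
    CircleRel v τ ((h ^ n) x) ((h ^ n) y) ↔ CircleRel v τ x y := by
  induction n with
  | zero => rfl
  | succ n ih =>
    rw [pow_succ', Perm.mul_apply, Perm.mul_apply, H.circleRel_h_iff hc hcc hcard ha, ih]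

omit [Fintype α] [DecidableEq α] in
lemma h_pow_flip (n : ℕ) (x : α) : (h ^ n) (τ x) = τ ((h ^ n) x) := by
  induction n with
  | zero => rfl
  | succ n ih => rw [pow_succ', Perm.mul_apply, Perm.mul_apply, ih, H.flip_h]

/-- The defect `c` lives on the pair of circles through `a`, so `h` commutes with `v` along the
orbit until that pair is reached again. -/
lemma h_pow_v (hc : ∀ x, h (v x) = c (v (h x)))
    (hcc : ∀ x, c (c x) = x) (hcard : c.support.card = 4) {a : α} (ha : c a ≠ a) {k : ℕ}
    (hk : ∀ i, 0 < i → i < k → ¬ CircleRel v τ a ((h ^ i) a)) {y : α} (hy : CircleRel v τ a y)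
    (i : ℕ) (hi : i < k) : (h ^ i) (v y) = v ((h ^ i) y) := by
  induction i with
  | zero => rfl
  | succ i ih =>
    rw [pow_succ', Perm.mul_apply, ih (by omega), hc, Perm.mul_apply]
    by_contra hne
    apply hk (i + 1) (by omega) hi
    have hR := H.circleRel_equivalence
    have h1 := H.circleRel_of_comm_ne hc hcc hcard ha (fun h => hne h)
    refine hR.trans h1 ?_
    have h2 : CircleRel v τ (v (h ((h ^ i) y))) ((h ^ (i + 1)) y) := by
      rw [pow_succ', Perm.mul_apply]
      exact Or.inl (Perm.sameCycle_apply_left.2 (Perm.SameCycle.refl _ _))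
    exact hR.trans h2 ((H.circleRel_h_pow_iff hc hcc hcard ha _ _ _).2 (hR.symm hy))

omit H [DecidableEq α] in
lemma exists_level_period (h v τ : Perm α) (a : α) (hR : CircleRel v τ a a) :
    ∃ k, 0 < k ∧ CircleRel v τ a ((h ^ k) a) ∧
      ∀ i, 0 < i → i < k → ¬ CircleRel v τ a ((h ^ i) a) := by
  classical
  have hex : ∃ k, 0 < k ∧ CircleRel v τ a ((h ^ k) a) :=
    ⟨orderOf h, orderOf_pos h, by rw [pow_orderOf_eq_one]; exact hR⟩
  obtain ⟨h1, h2⟩ := Nat.find_spec hex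
  exact ⟨Nat.find hex, h1, h2, fun s hs hst hsa => Nat.find_min hex hst ⟨hs, hsa⟩⟩

theorem exists_equiv_model (hc : ∀ x, h (v x) = c (v (h x)))
    (hcc : ∀ x, c (c x) = x) (hcard : c.support.card = 4) {a : α} (ha : c a ≠ a)
    {w : ℕ} [NeZero w] (hw : (v ^ w) a = a) (hmin : ∀ s, 0 < s → s < w → (v ^ s) a ≠ a) :
    ∃ k : ℕ, 0 < k ∧ ∃ (j : ZMod w) (d : ZMod w × Bool) (e : ZMod k × (ZMod w × Bool) ≃ α),
      j ≠ 0 ∧ h = e.permCongr (modelH k j d) ∧ v = e.permCongr (modelV w k) ∧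
        e (0, (0, false)) = a := by
  have hR := H.circleRel_equivalence
  have hinj := H.circleParam_injective hmin
  obtain ⟨j, hj, hjc⟩ := H.exists_circleParam_arcComm hc hcc hcard ha hw hmin
  obtain ⟨k, hk0, hka, hkmin⟩ := exists_level_period h v τ a (hR.refl a)
  have : NeZero k := ⟨hk0.ne'⟩
  obtain ⟨z, hz⟩ := H.exists_circleParam hw hka
  set f := circleParam v τ a w with hf
  have hfr : ∀ y, f (circleRot w y) = v (f y) := H.circleParam_rot hw
  have hfl : ∀ y, f (circleFlip w y) = τ (f y) := H.circleParam_flip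
  -- This choice makes the two descriptions of the first return map agree at the base point, as
  -- `arcFlip j` is an involution.
  set d := arcFlip j z with hd
  -- Both sides intertwine the rotation with `c v` and the flip with `τ`, so agreement at one point
  -- suffices.
  have hfd : ∀ y, f (arcFlip j (circleAut d y)) = (h ^ k) (f y) := by
    refine circle_map_ext (u := fun x => c (v x)) (t := τ) ?_ ?_ ?_ ?_ ?_
    · intro y
      rw [circleAut_rot, ← hfr, ← hjc, ← arcFlip_rot_arcFlip hj, arcFlip_arcFlip]
    · intro y
      obtain ⟨k, rfl⟩ : ∃ m, k = m + 1 := ⟨k - 1, by omega⟩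
      rw [hfr, pow_succ', Perm.mul_apply, H.h_pow_v hc hcc hcard ha hkmin
        (H.circleRel_circleParam y) k (by omega), hc, Perm.mul_apply]
    · intro y
      rw [circleAut_flip, arcFlip_flip, hfl]
    · intro y
      rw [hfl, H.h_pow_flip]
    · rw [circleAut_zero, hd, arcFlip_arcFlip, hz, hf, circleParam_zero]
  let F : ZMod k × (ZMod w × Bool) → α := fun y => (h ^ y.1.val) (f y.2)
  have hFV : ∀ y, F (modelV w k y) = v (F y) := by
    rintro ⟨i, y⟩
    change (h ^ i.val) (f (circleRot w y)) = v ((h ^ i.val) (f y))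
    rw [hfr, H.h_pow_v hc hcc hcard ha hkmin (H.circleRel_circleParam y) _
      (ZMod.val_lt i)]
  have hFT : ∀ y, F (modelFlip w k y) = τ (F y) := by
    rintro ⟨i, y⟩
    change (h ^ i.val) (f (circleFlip w y)) = τ ((h ^ i.val) (f y))
    rw [hfl, H.h_pow_flip]
  have hFH : ∀ y, F (modelH k j d y) = h (F y) := by
    rintro ⟨i, y⟩
    by_cases hi : i + 1 = 0
    · rw [modelH_of_eq _ _ hi]
      change (h ^ (0 : ZMod k).val) _ = h ((h ^ i.val) (f y))
      rw [ZMod.val_zero, pow_zero, Perm.one_apply, hfd, ← Perm.mul_apply, ← pow_succ']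
      congr 2
      have hlt := ZMod.val_lt i
      have h1 : ((i.val + 1 : ℕ) : ZMod k) = 0 := by
        push_cast; rw [ZMod.natCast_zmod_val, hi]
      rw [ZMod.natCast_eq_zero_iff] at h1
      have := Nat.le_of_dvd (by omega) h1
      omega
    · rw [modelH_of_ne _ _ hi]
      change (h ^ (i + 1).val) _ = h ((h ^ i.val) (f y))
      rw [zmod_val_add_one (fun h => hi (by rw [h]; ring)), pow_succ', Perm.mul_apply]
  have hF0 : F (0, (0, false)) = a := by
    change (h ^ (0 : ZMod k).val) (f (0, false)) = a
    rw [ZMod.val_zero, hf, circleParam_zero]; rfl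
  have hFinj : Function.Injective F := by
    have key : ∀ i i' : ZMod k, ∀ y y' : ZMod w × Bool, i.val ≤ i'.val →
        (h ^ i.val) (f y) = (h ^ i'.val) (f y') → (i, y) = (i', y') := by
      intro i i' y y' hle heq
      have h1 : f y = (h ^ (i'.val - i.val)) (f y') := by
        apply (h ^ i.val).injective
        rw [heq, ← Perm.mul_apply, ← pow_add]
        congr 2; omega
      have h2 : i'.val - i.val = 0 := by
        by_contra hne
        apply hkmin (i'.val - i.val) (by omega) (by have := ZMod.val_lt i'; omega)
        have h3 := H.circleRel_circleParam (a := a) y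
        rw [← hf, h1] at h3
        exact hR.trans h3 ((H.circleRel_h_pow_iff hc hcc hcard ha _ _ _).2
          (hR.symm (H.circleRel_circleParam y')))
      rw [h2, pow_zero, Perm.one_apply] at h1
      rw [hinj h1, ZMod.val_injective k (show i.val = i'.val by omega)]
    rintro ⟨i, y⟩ ⟨i', y'⟩ heq
    rcases Nat.le_total i.val i'.val with hle | hle
    · exact key i i' y y' hle heq
    · exact (key i' i y' y hle heq.symm).symm
  have hFsurj : Function.Surjective F := by
    intro x
    refine H.mem_of_invariant (Set.range F) ⟨a, _, hF0⟩ ?_ ?_ ?_ x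
    · rintro _ ⟨y, rfl⟩; exact ⟨_, hFH y⟩
    · rintro _ ⟨y, rfl⟩; exact ⟨_, hFV y⟩
    · rintro _ ⟨y, rfl⟩; exact ⟨_, hFT y⟩
  let e := Equiv.ofBijective F ⟨hFinj, hFsurj⟩
  refine ⟨k, hk0, j, d, e, hj, ?_, ?_, hF0⟩
  · ext1 x
    rw [permCongr_apply]
    have := hFH (e.symm x)
    rw [show F (e.symm x) = x from e.apply_symm_apply x] at this
    exact this.symm
  · ext1 x
    rw [permCongr_apply]
    have := hFV (e.symm x)
    rw [show F (e.symm x) = x from e.apply_symm_apply x] at this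
    exact this.symm

end RealTriple

/-! ### Rigidity of marked models and the exact count -/

/-- Only `h` and `v` are intertwined by `f`, not `τ`: the count is of pairs `(h, v)`, so the
parameters must be recovered from these alone. -/
lemma model_rigid {w k : ℕ} [NeZero w] [NeZero k] {j j' : ZMod w} (hj : j ≠ 0) (hj' : j' ≠ 0)
    {d d' : ZMod w × Bool} (f : Perm (ZMod k × (ZMod w × Bool)))
    (hh : ∀ y, f (modelH k j d y) = modelH k j' d' (f y))
    (hv : ∀ y, f (modelV w k y) = modelV w k (f y))
    (h0 : f (0, (0, false)) = (0, (0, false))) : j = j' ∧ d = d' ∧ f = 1 := by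
  have hC : ∀ y, f (Perm.prodExtendRight 0 (arcComm j) y) =
      Perm.prodExtendRight 0 (arcComm j') (f y) := by
    intro y
    obtain ⟨y, rfl⟩ := (modelV w k).surjective y
    obtain ⟨y, rfl⟩ := (modelH k j d).surjective y
    rw [← modelH_modelV hj, hh, hv, hv, hh, modelH_modelV hj']
  have h1 : ∀ n : ℕ, f (0, ((n : ZMod w), false)) = (0, ((n : ZMod w), false)) := by
    intro n
    induction n with
    | zero => simpa using h0
    | succ n ih =>
      have := hv (0, ((n : ZMod w), false))
      rw [ih, modelV_apply, circleRot_false] at this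
      simpa using this
  have h2 : ∀ x : ZMod w, f (0, (x, false)) = (0, (x, false)) := by
    intro x
    have := h1 x.val
    rwa [ZMod.natCast_zmod_val] at this
  -- On the circle through the base point the commutator moves only the points `0` and `j`.
  have hjj : j = j' := by
    have h3 := hC (0, (j, false))
    rw [h2, Perm.prodExtendRight_apply_eq, Perm.prodExtendRight_apply_eq, arcComm_self hj] at h3
    by_contra hne
    rw [arcComm_of_ne (by simpa using hj) (by simp) (by simpa using hne) (by simp), ← h2] at h3
    simpa using f.injective h3
  subst hjj
  -- `v` preserves each circle, so it is the commutator that passes from the first circle to its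
  -- conjugate.
  have h3 : f (0, (j - 1, true)) = (0, (j - 1, true)) := by
    have := hC (0, (0, false))
    rwa [h0, Perm.prodExtendRight_apply_eq, arcComm_zero hj] at this
  have h4 : ∀ n : ℕ, f (0, (j - 1 - (n : ZMod w), true)) =
      (0, (j - 1 - (n : ZMod w), true)) := by
    intro n
    induction n with
    | zero => simpa using h3
    | succ n ih =>
      have := hv (0, (j - 1 - (n : ZMod w), true))
      rw [ih, modelV_apply, circleRot_true] at this
      simpa [sub_sub, add_assoc] using this
  have h5 : ∀ y, f (0, y) = (0, y) := by
    rintro ⟨x, _ | _⟩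
    · exact h2 x
    · have := h4 (j - 1 - x).val
      rwa [ZMod.natCast_zmod_val, sub_sub_cancel] at this
  have h6 : ∀ n : ℕ, ∀ y, f ((n : ZMod k), y) = ((n : ZMod k), y) := by
    intro n
    induction n with
    | zero => simpa using h5
    | succ n ih =>
      intro y
      push_cast
      by_cases hn : (n : ZMod k) + 1 = 0
      · rw [hn, h5]
      · have := hh (n, y)
        rwa [ih, modelH_of_ne _ _ hn, modelH_of_ne _ _ hn] at this
  have h7 : f = 1 := by
    ext1 ⟨i, y⟩
    have := h6 i.val y
    rwa [ZMod.natCast_zmod_val] at this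
  refine ⟨rfl, ?_, h7⟩
  -- The gluing `d` is visible only on the step from level `-1` to level `0`.
  have h8 := hh (-1, (0, false))
  subst h7
  rw [Perm.one_apply, Perm.one_apply, modelH_of_eq _ _ (neg_add_cancel 1),
    modelH_of_eq _ _ (neg_add_cancel 1), circleAut_zero, circleAut_zero] at h8
  exact (arcFlip j).injective (Prod.mk.inj h8).2

lemma minimalPeriod_perm_eq_iff {α : Type*} {v : Perm α} {a : α} {w : ℕ} (hw : 0 < w) :
    Function.minimalPeriod v a = w ↔
      (v ^ w) a = a ∧ ∀ s, 0 < s → s < w → (v ^ s) a ≠ a := by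
  constructor
  · rintro rfl
    refine ⟨?_, fun s hs hsw h => ?_⟩
    · rw [← Perm.iterate_eq_pow]
      exact Function.iterate_minimalPeriod
    · refine Function.not_isPeriodicPt_of_pos_of_lt_minimalPeriod hs.ne' hsw ?_
      rw [Function.IsPeriodicPt, Function.IsFixedPt, Perm.iterate_eq_pow]
      exact h
  · rintro ⟨h1, h2⟩
    have hp : Function.IsPeriodicPt v w a := by
      rw [Function.IsPeriodicPt, Function.IsFixedPt, Perm.iterate_eq_pow]
      exact h1
    refine le_antisymm (hp.minimalPeriod_le hw) ?_
    by_contra hlt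
    apply h2 _ (hp.minimalPeriod_pos hw) (not_le.1 hlt)
    rw [← Perm.iterate_eq_pow]
    exact Function.iterate_minimalPeriod

lemma permCongr_comm_eq_swap {w k : ℕ} [NeZero w] {α : Type*} [DecidableEq α] {j : ZMod w}
    (hj : j ≠ 0) (d : ZMod w × Bool) (e : ZMod k × (ZMod w × Bool) ≃ α) :
    e.permCongr (modelH k j d) * e.permCongr (modelV w k) * (e.permCongr (modelH k j d))⁻¹ *
      (e.permCongr (modelV w k))⁻¹ =
    swap (e (0, (0, false))) (e (0, (j - 1, true))) *
      swap (e (0, (j, false))) (e (0, (-1, true))) := by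
  have h1 : ∀ p : Perm (ZMod k × (ZMod w × Bool)), e.permCongr p = e.permCongrHom p :=
    fun _ => rfl
  have h2 : ∀ x y, e.permCongr (swap x y) = swap (e x) (e y) := fun x y =>
    Equiv.symm_trans_swap_trans x y e
  rw [h1, h1, ← map_inv, ← map_inv, ← map_mul, ← map_mul, ← map_mul, modelH_comm hj,
    prodExtendRight_arcComm, map_mul, ← h1, ← h1, h2, h2]

open Classical in
/-- The pairs of permutations defining a real origami of degree `2m` in `H(1,1)`. -/
noncomputable def realPairs (m : ℕ) : Finset (Perm (Fin (2 * m)) × Perm (Fin (2 * m))) :=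
  Finset.univ.filter fun p => IsRealOrigami p.1 p.2 ∧ InStratum p.1 p.2 {1, 1}

lemma mem_realPairs {m : ℕ} {p : Perm (Fin (2 * m)) × Perm (Fin (2 * m))} :
    p ∈ realPairs m ↔ IsRealOrigami p.1 p.2 ∧ InStratum p.1 p.2 {1, 1} := by
  classical
  simp [realPairs]

/-- The pairs of `realPairs m` with a marked point not fixed by the commutator. -/
noncomputable def markedPairs (m : ℕ) :
    Finset (Σ _ : Perm (Fin (2 * m)) × Perm (Fin (2 * m)), Fin (2 * m)) :=
  (realPairs m).sigma fun p => (p.1 * p.2 * p.1⁻¹ * p.2⁻¹).support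

lemma mem_markedPairs {m : ℕ} {h v : Perm (Fin (2 * m))} {a : Fin (2 * m)} :
    (⟨(h, v), a⟩ : Σ _ : Perm (Fin (2 * m)) × Perm (Fin (2 * m)), Fin (2 * m)) ∈ markedPairs m ↔
      (∃ τ, RealTriple h v τ) ∧ (h * v * h⁻¹ * v⁻¹).cycleType = {2, 2} ∧
        (h * v * h⁻¹ * v⁻¹) a ≠ a := by
  simp only [markedPairs, Finset.mem_sigma, mem_realPairs, inStratum_one_one_iff, IsRealOrigami, isRealStructure_iff, Perm.mem_support, and_assoc]

lemma card_markedPairs (m : ℕ) : (markedPairs m).card = 4 * (realPairs m).card := by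
  rw [markedPairs, Finset.card_sigma, Finset.sum_const_nat (m := 4), mul_comm]
  intro p hp
  rw [mem_realPairs, inStratum_one_one_iff] at hp
  rw [← Perm.sum_cycleType, hp.2]
  rfl

lemma exists_model_of_mem_markedPairs {m : ℕ} {h v : Perm (Fin (2 * m))} {a : Fin (2 * m)}
    (hm : (⟨(h, v), a⟩ : Σ _ : Perm (Fin (2 * m)) × Perm (Fin (2 * m)), Fin (2 * m)) ∈
      markedPairs m) {w : ℕ} [NeZero w] (hw : Function.minimalPeriod v a = w) :
    ∃ k : ℕ, 0 < k ∧ ∃ (j : ZMod w) (d : ZMod w × Bool) (e : ZMod k × (ZMod w × Bool) ≃ Fin (2 * m)),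
      j ≠ 0 ∧ h = e.permCongr (modelH k j d) ∧ v = e.permCongr (modelV w k) ∧
        e (0, (0, false)) = a := by
  obtain ⟨⟨τ, H⟩, hct, ha⟩ := mem_markedPairs.1 hm
  set c := h * v * h⁻¹ * v⁻¹ with hcdef
  obtain ⟨h1, h2⟩ := (minimalPeriod_perm_eq_iff (NeZero.pos w)).1 hw
  refine H.exists_equiv_model (c := c) (fun x => ?_) (fun x => ?_) ?_ ha h1 h2
  · simp [hcdef]
  · have h3 : orderOf c = 2 := by rw [← Perm.lcm_cycleType, hct]; rfl
    have h4 := pow_orderOf_eq_one c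
    rw [h3, pow_two] at h4
    exact Perm.congr_fun h4 x
  · rw [← Perm.sum_cycleType, hct]; rfl

lemma card_eq_of_model_equiv {m w k : ℕ} [NeZero w] [NeZero k]
    (e : ZMod k × (ZMod w × Bool) ≃ Fin (2 * m)) : m = w * k := by
  have := Fintype.card_congr e
  simp only [Fintype.card_prod, ZMod.card, Fintype.card_bool, Fintype.card_fin] at this
  nlinarith

/-- The factors count the nonzero `j`, the gluings `d`, and the labellings `e` of the model by `Fin
(2 * m)`; rigidity makes this parametrization injective. -/
lemma card_markedPairs_filter {m w k : ℕ} [NeZero w] [NeZero k] (hm : m = w * k) :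
    ((markedPairs m).filter fun q => Function.minimalPeriod q.1.2 q.2 = w).card =
      (w - 1) * (w * 2 * (2 * m).factorial) := by
  classical
  let Ψ : {j : ZMod w // j ≠ 0} × (ZMod w × Bool) × (ZMod k × (ZMod w × Bool) ≃ Fin (2 * m)) →
      Σ _ : Perm (Fin (2 * m)) × Perm (Fin (2 * m)), Fin (2 * m) := fun p =>
    ⟨(p.2.2.permCongr (modelH k p.1 p.2.1), p.2.2.permCongr (modelV w k)), p.2.2 (0, (0, false))⟩
  have hΨ : Function.Injective Ψ := by
    rintro ⟨⟨j, hj⟩, d, e⟩ ⟨⟨j', hj'⟩, d', e'⟩ heq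
    simp only [Ψ, Sigma.mk.injEq, Prod.mk.injEq, heq_eq_eq] at heq
    obtain ⟨⟨h1, h2⟩, h3⟩ := heq
    obtain ⟨rfl, rfl, h4⟩ := model_rigid hj hj' (d := d) (d' := d') (e.trans e'.symm)
      (fun y => by
        have := Perm.congr_fun h1 (e y)
        simp only [permCongr_apply, symm_apply_apply] at this
        simp [this])
      (fun y => by
        have := Perm.congr_fun h2 (e y)
        simp only [permCongr_apply, symm_apply_apply] at this
        simp [this])
      (by simp [h3])
    have h5 : e = e' := by
      ext1 y
      have := Perm.congr_fun h4 y
      simp only [trans_apply, Perm.one_apply] at this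
      rw [← this, apply_symm_apply, this]
    rw [h5]
  have himg : (markedPairs m).filter (fun q => Function.minimalPeriod q.1.2 q.2 = w) =
      Finset.univ.image Ψ := by
    ext ⟨⟨h, v⟩, a⟩
    rw [Finset.mem_filter, Finset.mem_image]
    constructor
    · rintro ⟨h1, h2⟩
      obtain ⟨k', hk', j, d, e, hj, rfl, rfl, rfl⟩ := exists_model_of_mem_markedPairs h1 h2
      have : NeZero k' := ⟨hk'.ne'⟩
      have hkk : k' = k := Nat.eq_of_mul_eq_mul_left (NeZero.pos w)
        ((card_eq_of_model_equiv e).symm.trans hm)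
      subst hkk
      exact ⟨(⟨j, hj⟩, d, e), Finset.mem_univ _, rfl⟩
    · rintro ⟨⟨⟨j, hj⟩, d, e⟩, -, heq⟩
      simp only [Ψ, Sigma.mk.injEq, Prod.mk.injEq, heq_eq_eq] at heq
      obtain ⟨⟨rfl, rfl⟩, rfl⟩ := heq
      refine ⟨mem_markedPairs.2 ⟨⟨_, (model_realTriple d).permCongr e⟩, ?_, ?_⟩, ?_⟩
      · rw [permCongr_comm_eq_swap hj]
        apply cycleType_swap_mul_swap <;> simp [e.injective.eq_iff, hj, hj.symm]
      · have h1 : swap (e (0, (j, false))) (e (0, (-1, true))) (e (0, (0, false))) =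
            e (0, (0, false)) := swap_apply_of_ne_of_ne (by simp [hj.symm]) (by simp)
        rw [permCongr_comm_eq_swap hj, Perm.mul_apply, h1, swap_apply_left]
        simp
      · rw [minimalPeriod_perm_eq_iff (NeZero.pos w)]
        have h1 : ∀ n : ℕ, (e.permCongr (modelV w k) ^ n) (e (0, (0, false))) =
            e (0, ((n : ZMod w), false)) := by
          intro n
          have : e.permCongr (modelV w k) ^ n = e.permCongr (modelV w k ^ n) :=
            (map_pow e.permCongrHom (modelV w k) n).symm
          rw [this, permCongr_apply, symm_apply_apply, modelV_pow, circleRot_pow_false, zero_add]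
        refine ⟨by simp [h1], fun s hs hsw h2 => ?_⟩
        rw [h1, e.apply_eq_iff_eq] at h2
        simp only [Prod.mk.injEq, true_and, and_true] at h2
        rw [ZMod.natCast_eq_zero_iff] at h2
        exact absurd (Nat.le_of_dvd hs h2) (not_le.2 hsw)
  have e0 : ZMod k × (ZMod w × Bool) ≃ Fin (2 * m) := Fintype.equivOfCardEq (by
    simp only [Fintype.card_prod, ZMod.card, Fintype.card_bool, Fintype.card_fin, hm]; ring)
  rw [himg, Finset.card_image_of_injective _ hΨ, Finset.card_univ, Fintype.card_prod,
    Fintype.card_prod, Fintype.card_equiv e0, Fintype.card_subtype_compl]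
  simp only [Fintype.card_prod, ZMod.card, Fintype.card_bool, Fintype.card_unique]
  rw [hm]
  congr 3; ring

lemma four_mul_card_realPairs {m : ℕ} (hm : m ≠ 0) :
    4 * (realPairs m).card =
      ∑ w ∈ m.divisors, (w - 1) * (w * 2 * (2 * m).factorial) := by
  rw [← card_markedPairs, Finset.card_eq_sum_card_fiberwise (t := m.divisors)
    (f := fun q => Function.minimalPeriod q.1.2 q.2)]
  · refine Finset.sum_congr rfl fun w hw => ?_
    obtain ⟨k, hk⟩ := Nat.dvd_of_mem_divisors hw
    have : NeZero w := ⟨by rintro rfl; simp at hk; exact hm hk⟩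
    have : NeZero k := ⟨by rintro rfl; simp at hk; exact hm hk⟩
    exact card_markedPairs_filter hk
  · rintro ⟨⟨h, v⟩, a⟩ hq
    have hpos : 0 < Function.minimalPeriod v a := by
      refine Function.IsPeriodicPt.minimalPeriod_pos (orderOf_pos v) ?_
      rw [Function.IsPeriodicPt, Function.IsFixedPt, Perm.iterate_eq_pow, pow_orderOf_eq_one]
      rfl
    have : NeZero (Function.minimalPeriod v a) := ⟨hpos.ne'⟩
    obtain ⟨k, hk, j, d, e, -⟩ := exists_model_of_mem_markedPairs hq rfl
    have : NeZero k := ⟨hk.ne'⟩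
    exact Nat.mem_divisors.2 ⟨⟨k, card_eq_of_model_equiv e⟩, hm⟩

theorem realOrigamiCount_eq {m : ℕ} (hm : m ≠ 0) :
    realOrigamiCount m {1, 1} = ∑ w ∈ m.divisors, (w : ℝ) * (w - 1) / 2 := by
  have h1 : Set.ncard {p : Perm (Fin (2 * m)) × Perm (Fin (2 * m)) |
      IsRealOrigami p.1 p.2 ∧ InStratum p.1 p.2 {1, 1}} = (realPairs m).card := by
    rw [← Set.ncard_coe_finset]
    congr 1
    ext p
    simp [mem_realPairs]
  have hf : ((2 * m).factorial : ℝ) ≠ 0 := by positivity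
  rw [realOrigamiCount, h1, div_eq_iff hf]
  have h2 := congrArg (fun n : ℕ => (n : ℝ)) (four_mul_card_realPairs hm)
  push_cast at h2
  have h3 : ∀ w ∈ m.divisors, (((w - 1 : ℕ) : ℝ) * (w * 2 * (2 * m).factorial)) =
      4 * ((w : ℝ) * (w - 1) / 2 * (2 * m).factorial) := by
    intro w hw
    rw [Nat.cast_sub (Nat.pos_of_mem_divisors hw)]
    push_cast; ring
  rw [Finset.sum_congr rfl h3, ← Finset.mul_sum, ← Finset.sum_mul] at h2
  linarith

/-! ### Asymptotics of the divisor sum -/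

lemma hasSum_inv_cube : HasSum (fun n : ℕ => ((n : ℝ) ^ 3)⁻¹) (riemannZeta 3).re := by
  have h1 : riemannZeta 3 = ((∑' n : ℕ, ((n : ℝ) ^ 3)⁻¹ : ℝ) : ℂ) := by
    have := zeta_nat_eq_tsum_of_gt_one (k := 3) (by norm_num)
    push_cast at this ⊢
    rw [this]
    simp only [one_div]
  rw [h1, Complex.ofReal_re]
  exact (Real.summable_nat_pow_inv.2 (by norm_num)).hasSum

lemma sum_Ioc_inv_cube_bounds {n : ℕ} (hn : n ≠ 0) :
    ∑ k ∈ Finset.Ioc 0 n, ((k : ℝ) ^ 3)⁻¹ ≤ (riemannZeta 3).re ∧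
      (riemannZeta 3).re ≤ ∑ k ∈ Finset.Ioc 0 n, ((k : ℝ) ^ 3)⁻¹ + (n : ℝ)⁻¹ := by
  refine ⟨sum_le_hasSum _ (fun _ _ => by positivity) hasSum_inv_cube, ?_⟩
  refine le_of_tendsto hasSum_inv_cube.tendsto_sum_nat ?_
  filter_upwards [Filter.eventually_gt_atTop n] with N hN
  obtain ⟨M, rfl⟩ : ∃ M, N = M + 1 := ⟨N - 1, by omega⟩
  have h1 : ∑ k ∈ Finset.range (M + 1), ((k : ℝ) ^ 3)⁻¹ = ∑ k ∈ Finset.Ioc 0 M, ((k : ℝ) ^ 3)⁻¹ := by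
    rw [Finset.range_eq_Ico, Finset.sum_eq_sum_Ico_succ_bot (by omega)]
    simp only [Nat.cast_zero, ne_eq, OfNat.ofNat_ne_zero, not_false_eq_true, zero_pow, inv_zero,
      zero_add]
    rfl
  rw [h1, ← Finset.sum_Ioc_consecutive _ (Nat.zero_le n) (show n ≤ M by omega)]
  gcongr
  -- Comparison with inverse squares is crude, but a tail of `1 / n` costs only `n ^ 2` after
  -- multiplication by `n ^ 3`.
  calc ∑ k ∈ Finset.Ioc n M, ((k : ℝ) ^ 3)⁻¹ ≤ ∑ k ∈ Finset.Ioc n M, ((k : ℝ) ^ 2)⁻¹ := by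
        refine Finset.sum_le_sum fun k hk => ?_
        have hk1 : (1 : ℝ) ≤ k := by
          have := (Finset.mem_Ioc.1 hk).1
          exact_mod_cast (by omega : 1 ≤ k)
        gcongr
        norm_num
    _ ≤ (n : ℝ)⁻¹ - (M : ℝ)⁻¹ := sum_Ioc_inv_sq_le_sub hn (by omega)
    _ ≤ (n : ℝ)⁻¹ := by
        have : (0 : ℝ) ≤ (M : ℝ)⁻¹ := by positivity
        linarith

lemma sum_Ioc_mul_pred (M : ℕ) :
    ∑ w ∈ Finset.Ioc 0 M, (w : ℝ) * (w - 1) / 2 = ((M : ℝ) ^ 3 - M) / 6 := by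
  induction M with
  | zero => simp
  | succ M ih =>
    rw [Finset.sum_Ioc_succ_top (Nat.zero_le _), ih]
    push_cast; ring

lemma abs_sum_Ioc_mul_pred_sub_le {n k : ℕ} (hk : 0 < k) (hkn : k ≤ n) :
    |∑ w ∈ Finset.Ioc 0 (n / k), (w : ℝ) * (w - 1) / 2 - ((n : ℝ) / k) ^ 3 / 6| ≤
      ((n : ℝ) / k) ^ 2 := by
  rw [sum_Ioc_mul_pred]
  have h1 : ((n / k : ℕ) : ℝ) ≤ (n : ℝ) / k := Nat.cast_div_le
  have h2 : (n : ℝ) / k < ((n / k : ℕ) : ℝ) + 1 := by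
    rw [div_lt_iff₀ (by exact_mod_cast hk)]
    exact_mod_cast Nat.lt_mul_of_div_lt (Nat.lt_succ_self _) hk
  -- This is where `k ≤ n` enters: lower-order terms are absorbed into the square.
  have h3 : (1 : ℝ) ≤ (n : ℝ) / k := by
    rw [le_div_iff₀ (by exact_mod_cast hk), one_mul]
    exact_mod_cast hkn
  set x := (n : ℝ) / k
  set M := ((n / k : ℕ) : ℝ)
  have h4 : M ^ 3 ≤ x ^ 3 := by gcongr
  have h5 : (x - 1) ^ 3 ≤ M ^ 3 := pow_le_pow_left₀ (by linarith) (by linarith) 3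
  have h6 : 0 ≤ M := Nat.cast_nonneg _
  rw [abs_le]
  constructor <;> nlinarith

lemma sum_realOrigamiCount (n : ℕ) :
    ∑ m ∈ Finset.Icc 1 n, realOrigamiCount m {1, 1} =
      ∑ k ∈ Finset.Ioc 0 n, ∑ w ∈ Finset.Ioc 0 (n / k), (w : ℝ) * (w - 1) / 2 := by
  let g : ArithmeticFunction ℝ := ⟨fun w => (w : ℝ) * (w - 1) / 2, by simp⟩
  -- The count in degree `2 m` is the Dirichlet convolution of `g` with the constant `1`, so its
  -- summatory function regroups by the codivisor `k`.
  have h1 := ArithmeticFunction.sum_Ioc_mul_eq_sum_sum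
    (ArithmeticFunction.zeta : ArithmeticFunction ℝ) g n
  have h2 : ∑ m ∈ Finset.Icc 1 n, realOrigamiCount m {1, 1} =
      ∑ m ∈ Finset.Ioc 0 n, ((ArithmeticFunction.zeta : ArithmeticFunction ℝ) * g) m := by
    refine Finset.sum_congr rfl fun m hm => ?_
    rw [realOrigamiCount_eq (by have := (Finset.mem_Icc.1 hm).1; omega),
      ArithmeticFunction.coe_zeta_mul_apply]
    rfl
  rw [h2, h1]
  refine Finset.sum_congr rfl fun k hk => ?_
  have hk0 : k ≠ 0 := by have := (Finset.mem_Ioc.1 hk).1; omega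
  rw [ArithmeticFunction.natCoe_apply, ArithmeticFunction.zeta_apply_ne hk0, Nat.cast_one, one_mul]
  rfl

theorem mainTheorem10 :
    (fun n : ℕ => (∑ m ∈ Finset.Icc 1 n, realOrigamiCount m {1, 1})
        - (riemannZeta 3).re / 6 * (n : ℝ) ^ 3)
      =O[Filter.atTop] (fun n : ℕ => (n : ℝ) ^ 2) := by
  -- The constant is `2 + 1`: the bound `2` on the sum of inverse squares for the rounding errors,
  -- and `1` for truncating `ζ(3)`.
  refine Asymptotics.IsBigO.of_bound 3 ?_
  filter_upwards [Filter.eventually_ge_atTop 1] with n hn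
  have hn0 : (0 : ℝ) < n := by exact_mod_cast hn
  rw [Real.norm_eq_abs, Real.norm_of_nonneg (by positivity), sum_realOrigamiCount]
  obtain ⟨h1, h2⟩ := sum_Ioc_inv_cube_bounds (n := n) (by omega)
  set S := ∑ k ∈ Finset.Ioc 0 n, ((k : ℝ) ^ 3)⁻¹ with hS
  have h3 : |∑ k ∈ Finset.Ioc 0 n, ∑ w ∈ Finset.Ioc 0 (n / k), (w : ℝ) * (w - 1) / 2 -
      S * (n : ℝ) ^ 3 / 6| ≤ 2 * (n : ℝ) ^ 2 := by
    have h4 : S * (n : ℝ) ^ 3 / 6 = ∑ k ∈ Finset.Ioc 0 n, ((n : ℝ) / k) ^ 3 / 6 := by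
      rw [hS, Finset.sum_mul, Finset.sum_div]
      refine Finset.sum_congr rfl fun k _ => ?_
      rw [div_pow, div_eq_inv_mul ((n : ℝ) ^ 3)]
    have h5 : ∑ k ∈ Finset.Ioc 0 n, ((k : ℝ) ^ 2)⁻¹ ≤ 2 := by
      have := sum_Ioo_inv_sq_le (α := ℝ) 0 (n + 1)
      rw [show Finset.Ioc 0 n = Finset.Ioo 0 (n + 1) by ext; simp]
      simpa using this
    rw [h4, ← Finset.sum_sub_distrib]
    calc _ ≤ ∑ k ∈ Finset.Ioc 0 n, ((n : ℝ) / k) ^ 2 := by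
          refine (Finset.abs_sum_le_sum_abs _ _).trans (Finset.sum_le_sum fun k hk => ?_)
          obtain ⟨hk0, hkn⟩ := Finset.mem_Ioc.1 hk
          exact abs_sum_Ioc_mul_pred_sub_le hk0 hkn
      _ = (∑ k ∈ Finset.Ioc 0 n, ((k : ℝ) ^ 2)⁻¹) * (n : ℝ) ^ 2 := by
          rw [Finset.sum_mul]
          refine Finset.sum_congr rfl fun k _ => ?_
          rw [div_pow, div_eq_inv_mul]
      _ ≤ 2 * (n : ℝ) ^ 2 := by gcongr
  have h6 : |S * (n : ℝ) ^ 3 / 6 - (riemannZeta 3).re / 6 * (n : ℝ) ^ 3| ≤ (n : ℝ) ^ 2 := by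
    have h7 : ((riemannZeta 3).re - S) * (n : ℝ) ^ 3 ≤ (n : ℝ) ^ 2 := by
      calc ((riemannZeta 3).re - S) * (n : ℝ) ^ 3 ≤ (n : ℝ)⁻¹ * (n : ℝ) ^ 3 := by
            gcongr; linarith
        _ = (n : ℝ) ^ 2 := by field_simp
    have h8 : 0 ≤ ((riemannZeta 3).re - S) * (n : ℝ) ^ 3 :=
      mul_nonneg (by linarith) (by positivity)
    rw [abs_le]
    constructor <;> nlinarith
  calc _ ≤ _ := abs_sub_le _ (S * (n : ℝ) ^ 3 / 6) _
    _ ≤ 2 * (n : ℝ) ^ 2 + (n : ℝ) ^ 2 := add_le_add h3 h6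
    _ = 3 * (n : ℝ) ^ 2 := by ring
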